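/- **Setting.** Let $k\ge 3$ be an integer, $a>b>0$ reals, $\nu_1=\frac{1}{2(k-1)}$ and $\nu_2\in\left(\frac1{2(k-1)},\frac1k\right)$. Let $P_1,\dots,P_k$ be a partition $\mathcal P$ of $[n]$ with $\lfloor n/k\rfloor\le |P_i|\le\lceil n/k\rceil$ for all $i$ (the planted partition). In the stochastic block model $\mathcal G(n,k,p,q)$ with planted partition $\mathcal P$, each pair of nodes of $[n]$ is an edge independently, with probability $p$ if the two nodes lie in the same part $P_i$ and with probability $q$ otherwise. A $k$-partition $\mathcal A=(A_i)_{i=1}^k$ of $[n]$ is a partition of $[n]$ into $k$ parts, some of which may be empty; the labelling of the parts is immaterial. For $k$-partitions put $$d(\mathcal A,\mathcal B)=1-\frac1n\max_{\sigma}\sum_{i=1}^k|A_{\sigma(i)}\cap B_i| ,$$ the maximum being over the permutations $\sigma$ of $[k]$. For a graph $G=([n],E)$ with $m\ge1$ edges and degrees $d_u$, the modularity score is $$q_{\mathcal A}=q_{\mathcal A}(G)=\frac1{2m}\sum_{i=1}^k\ \sum_{u,v\in A_i}\Big(\mathbf 1_{\{uv\in E\}}-\frac{d_ud_v}{2m}\Big).$$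 Let $\mathcal E_{\rm close}=\{\mathcal A: d(\mathcal P,\mathcal A)\le\nu_1\}$, $\mathcal E_{\rm far}=\{\mathcal A: d(\mathcal P,\mathcal A)\ge\nu_2\}$, and for $\beta>0$ let $$\mathbb P_{\rm Gibbs}(\mathcal A)=\frac{\exp(\beta n q_{\mathcal A})}{\sum_{\mathcal B}\exp(\beta n q_{\mathcal B})},$$ where $\mathcal B$ runs over all $k$-partitions. Given $G$ and $\beta$, let $(\mathcal A_t)_{t\ge0}$ be the Markov chain on $k$-partitions with transition probabilities $$\mathbb P(\mathcal A\to\mathcal A')=\frac{\exp(\beta n q_{\mathcal A'})}{\sum_{\mathcal B:\,d(\mathcal A,\mathcal B)=1/n}\exp(\beta n q_{\mathcal B})}\qquad\text{if } d(\mathcal A,\mathcal A')=\tfrac1n ,$$ and $0$ otherwise, started from the Gibbs distribution conditioned on $\mathcal E_{\rm far}$, that is, $\mathbb P(\mathcal A_0=\mathcal A)=\mathbb P_{\rm Gibbs}(\mathcal A)/\sum_{\mathcal B\in\mathcal E_{\rm far}}\mathbb P_{\rm Gibbs}(\mathcal B)$ for $\mathcal A\in\mathcal E_{\rm far}$ and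 $\mathbb P(\mathcal A_0=\mathcal A)=0$ otherwise. Let $\tau=\min\{t:\mathcal A_t\in\mathcal E_{\rm close}\}$ (with $\tau=\infty$ if there is no such $t$). **Theorem.** For all $k,a,b,\nu_2$ as above there exist $\beta_0>0$ and $c_3,c_4>0$ such that for every $\varepsilon>0$ there exist $c>0$ and $n_0$ such that the following holds for all $\beta\ge\beta_0$, all $n\ge n_0$, every planted partition $\mathcal P$ as above, and all $\omega>c$ for which $p=\omega a/n$ and $q=\omega b/n$ lie in $[0,1]$. With probability at least $1-\varepsilon$ over $G\in\mathcal G(n,k,p,q)$, $$\mathbb P\big(\tau\ge\exp(c_3n)\big)\ \ge\ 1-\exp(-c_4n),$$ where this last probability is over the Markov chain, for the given $G$. -/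

import Mathlib

open MeasureTheory ProbabilityTheory
open scoped ENNReal

noncomputable section

namespace SBM

/-! ### Partitions into at most `k` parts -/

/-- The part `A_i` of the labelled partition `(A_1, …, A_k)` of `[n]` that is given by the
labelling `f`, where `f v` is the label of the part of `v`; parts may be empty. -/
def part {n k : ℕ} (f : Fin n → Fin k) (i : Fin k) : Finset (Fin n) :=
  Finset.univ.filter fun v => f v = i

/-- Two labelled partitions are the same partition if they differ by a permutation of labels. -/
def relabel (n k : ℕ) : Setoid (Fin n → Fin k) where
  r f g := ∃ σ : Equiv.Perm (Fin k), g = σ ∘ f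
  iseqv :=
    { refl := fun _ => ⟨1, rfl⟩
      symm := by
        rintro f g ⟨σ, rfl⟩
        exact ⟨σ⁻¹, by funext v; simp⟩
      trans := by
        rintro f g h ⟨σ, rfl⟩ ⟨τ, rfl⟩
        exact ⟨τ * σ, by funext v; simp⟩ }

/-- The `k`-partitions of `[n]`: (unlabelled) partitions of `[n]` into at most `k` nonempty parts,
that is, `k`-tuples of pairwise disjoint, possibly empty, sets that cover `[n]`, up to the order
of the tuple. -/
def KPartition (n k : ℕ) : Type := Quotient (relabel n k)

instance (n k : ℕ) : Finite (KPartition n k) :=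
  inferInstanceAs (Finite (Quotient (relabel n k)))

instance (n k : ℕ) : Fintype (KPartition n k) := Fintype.ofFinite _

instance (n k : ℕ) : MeasurableSpace (KPartition n k) := ⊤

instance (n k : ℕ) : DiscreteMeasurableSpace (KPartition n k) := ⟨fun _ => trivial⟩

/-- The partition with a given labelling. -/
def KPartition.mk {n k : ℕ} (f : Fin n → Fin k) : KPartition n k := Quotient.mk (relabel n k) f

lemma part_relabel {n k : ℕ} (f : Fin n → Fin k) (σ : Equiv.Perm (Fin k)) (i : Fin k) :
    part (σ ∘ f) (σ i) = part f i := by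
  ext v; simp [part]

/-! ### Distance between partitions -/

/-- `max_σ ∑_i |A_{σ(i)} ∩ B_i|` over all permutations `σ` of the labels. -/
def overlapLabelled {n k : ℕ} (f g : Fin n → Fin k) : ℕ :=
  Finset.univ.sup fun σ : Equiv.Perm (Fin k) => ∑ i, (part f (σ i) ∩ part g i).card

lemma overlapLabelled_relabel {n k : ℕ} (f g : Fin n → Fin k) (τ ρ : Equiv.Perm (Fin k)) :
    overlapLabelled (τ ∘ f) (ρ ∘ g) = overlapLabelled f g := by
  have key : ∀ (f g : Fin n → Fin k) (τ ρ : Equiv.Perm (Fin k)),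
      overlapLabelled f g ≤ overlapLabelled (τ ∘ f) (ρ ∘ g) := by
    intro f g τ ρ
    refine Finset.sup_le fun σ _ => ?_
    refine le_trans (le_of_eq ?_) (Finset.le_sup (Finset.mem_univ (τ * σ * ρ⁻¹)))
    rw [← Equiv.sum_comp ρ (fun i => (part (τ ∘ f) ((τ * σ * ρ⁻¹) i) ∩ part (ρ ∘ g) i).card)]
    refine Finset.sum_congr rfl fun i _ => ?_
    have e : ρ⁻¹ (ρ i) = i := ρ.symm_apply_apply i
    simp only [Equiv.Perm.mul_apply, e, part_relabel]
  refine le_antisymm ?_ (key f g τ ρ)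
  have h := key (τ ∘ f) (ρ ∘ g) τ⁻¹ ρ⁻¹
  have e1 : (⇑τ⁻¹ ∘ ⇑τ ∘ f) = f := by funext v; simp
  have e2 : (⇑ρ⁻¹ ∘ ⇑ρ ∘ g) = g := by funext v; simp
  rwa [e1, e2] at h

def overlap {n k : ℕ} (A B : KPartition n k) : ℕ :=
  Quotient.lift₂ overlapLabelled
    (by rintro f g f' g' ⟨τ, rfl⟩ ⟨ρ, rfl⟩; exact (overlapLabelled_relabel f g τ ρ).symm) A B

/-- The distance `d(A, B) = 1 - (1/n) max_σ ∑_i |A_{σ(i)} ∩ B_i|`. -/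
def distance {n k : ℕ} (A B : KPartition n k) : ℝ := 1 - (1 / (n : ℝ)) * (overlap A B : ℝ)

/-! ### Modularity -/

open Classical in
/-- The modularity score
`(1 / 2m) ∑_i ∑_{u, v ∈ A_i} (1[uv ∈ E] - d_u d_v / 2m)`, with `m` the number of edges. -/
def modularityLabelled {n k : ℕ} (G : SimpleGraph (Fin n)) (f : Fin n → Fin k) : ℝ :=
  1 / (2 * (G.edgeFinset.card : ℝ)) * ∑ i, ∑ u ∈ part f i, ∑ v ∈ part f i,
    ((if G.Adj u v then 1 else 0)
      - (G.degree u : ℝ) * (G.degree v : ℝ) / (2 * (G.edgeFinset.card : ℝ)))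

lemma modularityLabelled_relabel {n k : ℕ} (G : SimpleGraph (Fin n)) (f : Fin n → Fin k)
    (σ : Equiv.Perm (Fin k)) : modularityLabelled G (σ ∘ f) = modularityLabelled G f := by
  classical
  unfold modularityLabelled
  congr 1
  rw [← Equiv.sum_comp σ]
  simp only [part_relabel]

/-- The modularity score `q_A(G)` of the partition `A` of the vertices of `G`. -/
def modularity {n k : ℕ} (G : SimpleGraph (Fin n)) (A : KPartition n k) : ℝ :=
  Quotient.lift (modularityLabelled G)
    (by rintro f _ ⟨σ, rfl⟩; exact (modularityLabelled_relabel G f σ).symm) A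

/-! ### The stochastic block model -/

/-- The communities `P_1, …, P_k` have sizes `⌊n/k⌋ ≤ |P_i| ≤ ⌈n/k⌉`. -/
def IsBalanced {n k : ℕ} (P : Fin n → Fin k) : Prop :=
  ∀ i, ⌊(n : ℝ) / k⌋₊ ≤ (part P i).card ∧ (part P i).card ≤ ⌈(n : ℝ) / k⌉₊

/-- The pairs `u < v` of vertices, one for each potential edge. -/
abbrev VertexPair (n : ℕ) : Type := {e : Fin n × Fin n // e.1 < e.2}

/-- The graph in which the pair `u < v` is an edge iff `x (u, v) = true`. -/
def graphOfBits {n : ℕ} (x : VertexPair n → Bool) : SimpleGraph (Fin n) where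
  Adj u v := (∃ h : u < v, x ⟨(u, v), h⟩ = true) ∨ (∃ h : v < u, x ⟨(v, u), h⟩ = true)
  symm := ⟨fun _ _ h => h.symm⟩
  loopless := ⟨fun u h => by rcases h with ⟨h, -⟩ | ⟨h, -⟩ <;> exact lt_irrefl u h⟩

/-- The law of the stochastic block model with communities given by `P`: pairs of vertices are
edges independently, with probability `p` within a community and `q` between communities. -/
def sbm {n k : ℕ} (P : Fin n → Fin k) (p q : unitInterval) : Measure (SimpleGraph (Fin n)) :=
  (Measure.pi fun e : VertexPair n =>
    bernoulliMeasure true false (if P e.1.1 = P e.1.2 then p else q)).map graphOfBits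

/-! ### The Gibbs distribution and the Markov chain -/

/-- The weight `exp(β n q_A(G))`. -/
def weight {n k : ℕ} (G : SimpleGraph (Fin n)) (β : ℝ) (A : KPartition n k) : ℝ :=
  Real.exp (β * n * modularity G A)

/-- The Gibbs distribution `exp(β n q_A) / Z`. -/
def gibbs {n k : ℕ} (G : SimpleGraph (Fin n)) (β : ℝ) (A : KPartition n k) : ℝ :=
  weight G β A / ∑ B : KPartition n k, weight G β B

/-- Partitions at distance at most `ν₁` from the partition `P`. -/
def close {n k : ℕ} (P : KPartition n k) (ν₁ : ℝ) : Set (KPartition n k) :=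
  {A | distance P A ≤ ν₁}

/-- Partitions at distance at least `ν₂` from the partition `P`. -/
def far {n k : ℕ} (P : KPartition n k) (ν₂ : ℝ) : Set (KPartition n k) :=
  {A | ν₂ ≤ distance P A}

open Classical in
/-- The Gibbs distribution conditioned on `S`. -/
def gibbsOn {n k : ℕ} (G : SimpleGraph (Fin n)) (β : ℝ) (S : Set (KPartition n k)) :
    Measure (KPartition n k) :=
  ∑ A : KPartition n k,
    ENNReal.ofReal (if A ∈ S then
      gibbs G β A / ∑ B ∈ Finset.univ.filter (fun B => B ∈ S), gibbs G β B else 0) •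
        Measure.dirac A

open Classical in
/-- The partitions `B` with `d(A, B) = 1/n`. -/
def neighbours {n k : ℕ} (A : KPartition n k) : Finset (KPartition n k) :=
  Finset.univ.filter fun B => distance A B = 1 / (n : ℝ)

open Classical in
/-- One step of the chain: from `A` move to a `B` with `d(A, B) = 1/n`, with probability
`exp(β n q_B) / ∑_C exp(β n q_C)`, where `C` runs over the partitions with `d(A, C) = 1/n`.
(If there is no such partition, which can only happen for `n ≤ 1` or `k ≤ 1`, the chain stays.) -/
def step {n k : ℕ} (G : SimpleGraph (Fin n)) (β : ℝ) (A : KPartition n k) :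
    Measure (KPartition n k) :=
  if (neighbours A).Nonempty then
    ∑ B ∈ neighbours A,
      ENNReal.ofReal (weight G β B / ∑ C ∈ neighbours A, weight G β C) • Measure.dirac B
  else Measure.dirac A

lemma weight_pos {n k : ℕ} (G : SimpleGraph (Fin n)) (β : ℝ) (A : KPartition n k) :
    0 < weight G β A := Real.exp_pos _

instance {n k : ℕ} (G : SimpleGraph (Fin n)) (β : ℝ) (A : KPartition n k) :
    IsProbabilityMeasure (step G β A) := by
  classical
  unfold step
  split_ifs with h
  · constructor
    have hpos : 0 < ∑ C ∈ neighbours A, weight G β C :=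
      Finset.sum_pos (fun C _ => weight_pos G β C) h
    simp only [Measure.coe_finsetSum, Finset.sum_apply, Measure.smul_apply, measure_univ,
      smul_eq_mul, mul_one]
    rw [← ENNReal.ofReal_sum_of_nonneg
      (fun B _ => div_nonneg (weight_pos G β B).le hpos.le), ← Finset.sum_div,
      div_self hpos.ne', ENNReal.ofReal_one]
  · infer_instance

/-- The transition kernel of the chain. -/
def stepKernel {n k : ℕ} (G : SimpleGraph (Fin n)) (β : ℝ) :
    Kernel (KPartition n k) (KPartition n k) where
  toFun := step G β
  measurable' := Measurable.of_discrete

instance {n k : ℕ} (G : SimpleGraph (Fin n)) (β : ℝ) :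
    IsMarkovKernel (stepKernel (k := k) G β) :=
  ⟨fun A => inferInstanceAs (IsProbabilityMeasure (step G β A))⟩

/-- The transition kernel at time `t` as a kernel from histories `(A_0, …, A_t)`: it only looks
at the present state `A_t`. -/
def historyKernel {n k : ℕ} (G : SimpleGraph (Fin n)) (β : ℝ) (t : ℕ) :
    Kernel ((_ : Finset.Iic t) → KPartition n k) (KPartition n k) :=
  (stepKernel G β).comap (fun h => h ⟨t, Finset.mem_Iic.2 le_rfl⟩) (measurable_pi_apply _)

instance {n k : ℕ} (G : SimpleGraph (Fin n)) (β : ℝ) (t : ℕ) :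
    IsMarkovKernel (historyKernel (k := k) G β t) := by
  unfold historyKernel; infer_instance

/-- The law of the trajectory `(A_0, A_1, A_2, …)` of the Markov chain with initial
distribution `μ`. -/
def chain {n k : ℕ} (G : SimpleGraph (Fin n)) (β : ℝ) (μ : Measure (KPartition n k)) :
    Measure (ℕ → KPartition n k) :=
  Kernel.trajMeasure (X := fun _ => KPartition n k) μ (historyKernel G β)

/-- The hitting time `min {t | A_t ∈ S}`, equal to `∞` if there is no such `t`. -/
def hittingTime {α : Type*} (S : Set α) (X : ℕ → α) : ℕ∞ :=
  ⨅ t ∈ {t : ℕ | X t ∈ S}, (t : ℕ∞)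

end SBM

end

/-!
Why the chain is slow. Suppose first that the edge counts are exactly as expected. Then, up to
`O(1/n)`, the modularity of a labelling `f` is a multiple of its normalised `score`, the quadratic
form `∑_{u,v} 1[f u = f v] (1[P u = P v] - 1/k)` divided by `n²`. The form is expanded at `P`
(`score_eq`): if `f` differs from `P` in `t n` vertices, twice the linear part is
`-2 t n² / k + O(n)`, and every pair of misplaced vertices contributes at most `2 (1 - 1/k)` to the
quadratic part. So the score is at most `score P P + profile k t * n² + O(n)`, and merging two
communities attains this at `t = 1/k`, up to `O(n)`. The profile `-2 t / k + 2 (1 - 1/k) t²`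
increases on `[1 / (2 (k - 1)), 1/k]`, so every partition at distance between `1 / (2 (k - 1))` and
`ν < 1/k` has a score smaller by a constant times `n²` than the merged partition, which is far
from `P` (`exists_score_gap`). This is the energy barrier.

For a random graph, the modularity of `f` is determined by few linear forms in the adjacency
matrix: twice the number of edges inside parts, the total degrees of the parts, and `2 m`. For all
`f` together these are at most `(k + 1) k ^ n` forms, and Bernstein's inequality with a union bound
shows that they are all within `η ω n` of their expected values once `ω` is large
(`le_sbm_forall_form_le`). Then the modularity of every labelling is within a small constant of a
multiple of its normalised score (`abs_modularityLabelled_sub_score_le`). As the score changes by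
`O(n)` when one vertex moves, this also bounds the change of modularity in one step of the chain;
no bound on the maximum degree is needed.

The chain is reversible with respect to `π(A) = w(A) N(A)`, where `w` is the Gibbs weight and `N(A)`
the sum of the weights of the neighbours of `A` (`revMeasure_bind`). The Gibbs distribution on the
far region is not invariant, and its density `1 / (W N(A))` with respect to `π`, where `W` is the
total weight of the far region, is large where the modularity is small. But `W` is at least the
weight of the merged partition `A₀`, and `N(A)` is nearly as large unless the modularity of `A` is
well below that of `A₀`; partitions of the latter kind have exponentially small mass
(`gibbsOn_le`). Hence at any fixed time the chain is in the barrier with probability at most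
`2 exp (-4 n)` (`chain_mem_barrier_le`). A step changes the distance to `P` by at most `1/n`, so a
path from the far to the close region visits the barrier (`exists_mem_barrier`), and a union bound
over `exp n` time steps concludes.
-/

noncomputable section

namespace SBM

/-! ### Distance and Hamming distance of labellings -/

lemma sum_card_inter_add_hammingDist {n k : ℕ} (f g : Fin n → Fin k) (σ : Equiv.Perm (Fin k)) :
    ∑ i, (part f (σ i) ∩ part g i).card + hammingDist f (σ ∘ g) = n := by
  have h : ∑ i, (part f (σ i) ∩ part g i).card
      = (Finset.univ.filter fun v => f v = (σ ∘ g) v).card := by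
    rw [Finset.card_eq_sum_card_fiberwise (f := g) (t := Finset.univ) (by simp [Set.MapsTo])]
    refine Finset.sum_congr rfl fun i _ => congrArg _ ?_
    ext v
    simp only [part, Finset.mem_inter, Finset.mem_filter, Finset.mem_univ, true_and,
      Function.comp_apply]
    exact ⟨fun ⟨h1, h2⟩ => ⟨by rw [h1, h2], h2⟩, fun ⟨h1, h2⟩ => ⟨by rw [h1, h2], h2⟩⟩
  rw [h, hammingDist, Finset.card_filter_add_card_filter_not (s := Finset.univ)]
  simp

lemma le_overlapLabelled_add_hammingDist {n k : ℕ} (f g : Fin n → Fin k)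
    (σ : Equiv.Perm (Fin k)) : n ≤ overlapLabelled f g + hammingDist f (σ ∘ g) := by
  have h := sum_card_inter_add_hammingDist f g σ
  have h2 : ∑ i, (part f (σ i) ∩ part g i).card ≤ overlapLabelled f g :=
    Finset.le_sup (f := fun σ : Equiv.Perm (Fin k) => ∑ i, (part f (σ i) ∩ part g i).card)
      (Finset.mem_univ σ)
  omega

lemma exists_overlapLabelled_add_hammingDist {n k : ℕ} (f g : Fin n → Fin k) :
    ∃ σ : Equiv.Perm (Fin k), overlapLabelled f g + hammingDist f (σ ∘ g) = n := by
  obtain ⟨σ, -, h⟩ := Finset.exists_mem_eq_sup Finset.univ Finset.univ_nonempty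
    fun σ : Equiv.Perm (Fin k) => ∑ i, (part f (σ i) ∩ part g i).card
  refine ⟨σ, ?_⟩
  have h' : overlapLabelled f g = ∑ i, (part f (σ i) ∩ part g i).card := h
  rw [h', sum_card_inter_add_hammingDist]

lemma exists_mk {n k : ℕ} (A : KPartition n k) : ∃ f, KPartition.mk f = A :=
  Quotient.exists_rep A

lemma mk_comp_perm {n k : ℕ} (f : Fin n → Fin k) (σ : Equiv.Perm (Fin k)) :
    KPartition.mk (σ ∘ f) = KPartition.mk f :=
  Quotient.sound ⟨σ⁻¹, by funext v; simp⟩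

lemma overlap_mk {n k : ℕ} (f g : Fin n → Fin k) :
    overlap (KPartition.mk f) (KPartition.mk g) = overlapLabelled f g := rfl

lemma distance_eq {n k : ℕ} (hn : 0 < n) {A B : KPartition n k} {m : ℕ}
    (h : overlap A B + m = n) : distance A B = (m : ℝ) / n := by
  have hn' : (n : ℝ) ≠ 0 := by positivity
  have h' : (overlap A B : ℝ) + m = n := by exact_mod_cast h
  rw [distance]
  field_simp
  linarith

/-- The labels of `A` can be chosen so that the distance to a labelled partition is the
normalised Hamming distance of the labellings. -/
lemma exists_distance_eq_hammingDist {n k : ℕ} (hn : 0 < n) (f : Fin n → Fin k)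
    (A : KPartition n k) :
    ∃ g, KPartition.mk g = A ∧ distance (KPartition.mk f) A = (hammingDist f g : ℝ) / n := by
  obtain ⟨g, rfl⟩ := exists_mk A
  obtain ⟨σ, hσ⟩ := exists_overlapLabelled_add_hammingDist f g
  exact ⟨σ ∘ g, mk_comp_perm g σ, distance_eq hn hσ⟩

lemma distance_mk_le_hammingDist {n k : ℕ} (hn : 0 < n) (f g : Fin n → Fin k) :
    distance (KPartition.mk f) (KPartition.mk g) ≤ (hammingDist f g : ℝ) / n := by
  obtain ⟨σ, hσ⟩ := exists_overlapLabelled_add_hammingDist f g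
  rw [distance_eq hn hσ]
  have h := le_overlapLabelled_add_hammingDist f g 1
  have e : ((1 : Equiv.Perm (Fin k)) ∘ g) = g := rfl
  rw [e] at h
  gcongr
  omega

lemma distance_triangle {n k : ℕ} (hn : 0 < n) (A B C : KPartition n k) :
    distance A C ≤ distance A B + distance B C := by
  obtain ⟨f, rfl⟩ := exists_mk A
  obtain ⟨g, rfl, hg⟩ := exists_distance_eq_hammingDist hn f B
  obtain ⟨h, rfl, hh⟩ := exists_distance_eq_hammingDist hn g C
  refine (distance_mk_le_hammingDist hn f h).trans ?_
  rw [hg, hh, ← add_div]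
  gcongr
  exact_mod_cast hammingDist_triangle f g h

lemma distance_comm {n k : ℕ} (hn : 0 < n) (A B : KPartition n k) :
    distance A B = distance B A := by
  have key : ∀ A B : KPartition n k, distance A B ≤ distance B A := by
    intro A B
    obtain ⟨f, rfl⟩ := exists_mk B
    obtain ⟨g, rfl, hg⟩ := exists_distance_eq_hammingDist hn f A
    rw [hg, hammingDist_comm]
    exact distance_mk_le_hammingDist hn g f
  exact le_antisymm (key A B) (key B A)

lemma mem_neighbours {n k : ℕ} (A B : KPartition n k) :
    B ∈ neighbours A ↔ distance A B = 1 / (n : ℝ) := by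
  simp [neighbours]

lemma mem_neighbours_comm {n k : ℕ} (hn : 0 < n) (A B : KPartition n k) :
    B ∈ neighbours A ↔ A ∈ neighbours B := by
  rw [mem_neighbours, mem_neighbours, distance_comm hn]

lemma distance_le_of_mem_neighbours {n k : ℕ} (hn : 0 < n) (P : KPartition n k)
    {A B : KPartition n k} (h : B ∈ neighbours A) :
    distance P A ≤ distance P B + 1 / n := by
  rw [mem_neighbours_comm hn, mem_neighbours] at h
  rw [← h]
  exact distance_triangle hn P B A

/-- Neighbours have labellings that differ in exactly one vertex. -/
lemma exists_labellings_of_mem_neighbours {n k : ℕ} (hn : 0 < n) {A B : KPartition n k}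
    (h : B ∈ neighbours A) :
    ∃ f g, KPartition.mk f = A ∧ KPartition.mk g = B ∧ hammingDist f g = 1 := by
  obtain ⟨f, rfl⟩ := exists_mk A
  obtain ⟨g, rfl, hg⟩ := exists_distance_eq_hammingDist hn f B
  refine ⟨f, g, rfl, rfl, ?_⟩
  rw [mem_neighbours, hg] at h
  have hn' : (n : ℝ) ≠ 0 := by positivity
  field_simp at h
  exact_mod_cast h

/-- If `n > k ≥ 2`, two vertices share a part; separating them gives a different partition at
distance `1 / n`. -/
lemma neighbours_nonempty {n k : ℕ} (hk : 2 ≤ k) (hn : k < n) (A : KPartition n k) :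
    (neighbours A).Nonempty := by
  classical
  have hn0 : 0 < n := by omega
  obtain ⟨f, rfl⟩ := exists_mk A
  obtain ⟨u, v, huv, hf⟩ := Fintype.exists_ne_map_eq_of_card_lt f (by simpa using hn)
  have : Nontrivial (Fin k) := Fin.nontrivial_iff_two_le.2 hk
  obtain ⟨c, hc⟩ := exists_ne (f u)
  set g := Function.update f u c with hg
  refine ⟨KPartition.mk g, ?_⟩
  have hle : hammingDist f g ≤ 1 := by
    rw [hammingDist]
    refine (Finset.card_le_card (t := {u}) fun w hw => ?_).trans (by simp)
    by_contra hwu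
    simp only [Finset.mem_singleton] at hwu
    simp [hg, Function.update_of_ne hwu] at hw
  obtain ⟨σ, hσ⟩ := exists_overlapLabelled_add_hammingDist f g
  have h1 := le_overlapLabelled_add_hammingDist f g 1
  have e : ((1 : Equiv.Perm (Fin k)) ∘ g) = g := rfl
  rw [e] at h1
  have hpos : hammingDist f (σ ∘ g) ≠ 0 := by
    intro h0
    have h0 := eq_of_hammingDist_eq_zero h0
    have hu := congrFun h0 u
    have hv := congrFun h0 v
    simp only [Function.comp_apply] at hu hv
    rw [← hf, hu] at hv
    have := σ.injective hv
    rw [hg, Function.update_self, Function.update_of_ne huv.symm, ← hf] at this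
    exact hc this
  rw [mem_neighbours, distance_eq hn0 (m := 1) (by rw [overlap_mk]; omega)]
  simp

lemma card_kPartition_le (n k : ℕ) : Fintype.card (KPartition n k) ≤ k ^ n := by
  classical
  have h := Fintype.card_le_of_surjective (KPartition.mk : (Fin n → Fin k) → KPartition n k)
    exists_mk
  simpa using h

/-- A partition with an empty part misplaces all vertices of some part of `P`, whatever the
labels. -/
lemma le_distance_of_unused_label {n k : ℕ} (hn : 0 < n) (P f : Fin n → Fin k) (i : Fin k)
    (hi : ∀ v, f v ≠ i) (m : ℕ) (hm : ∀ j, m ≤ (part P j).card) :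
    (m : ℝ) / n ≤ distance (KPartition.mk P) (KPartition.mk f) := by
  obtain ⟨σ, hσ⟩ := exists_overlapLabelled_add_hammingDist P f
  rw [distance_eq hn hσ]
  gcongr
  refine (hm (σ i)).trans ?_
  rw [hammingDist]
  refine Finset.card_le_card fun v hv => ?_
  simp only [part, Finset.mem_filter, Finset.mem_univ, true_and, Function.comp_apply] at hv ⊢
  rw [hv]
  exact fun h => hi v (σ.injective h).symm

/-! ### The limiting modularity as a quadratic form -/

/-- The score `∑_{u,v} 1[f u = f v] (1[P u = P v] - 1/k)`. Up to the factor `(a - b) / (s n²)`,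
where `s = (a + (k - 1) b) / k`, this is the value around which the modularity of `f`
concentrates when the communities are given by `P`. -/
def score {n k : ℕ} (P f : Fin n → Fin k) : ℝ :=
  ∑ u, ∑ v, (if f u = f v then 1 else 0) * ((if P u = P v then 1 else 0) - 1 / (k : ℝ))

lemma abs_ite_sub_inv_le_one {k : ℕ} (p : Prop) [Decidable p] :
    |(if p then (1 : ℝ) else 0) - 1 / (k : ℝ)| ≤ 1 := by
  have h0 : (0 : ℝ) ≤ 1 / k := by positivity
  have h1 : 1 / (k : ℝ) ≤ 1 := by
    rw [one_div]
    exact Nat.cast_inv_le_one k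
  rw [abs_le]
  split_ifs <;> constructor <;> linarith

/-- Changing one label changes the score by at most `2 n`. -/
lemma abs_score_sub_score_le {n k : ℕ} (P f g : Fin n → Fin k) :
    |score P f - score P g| ≤ 2 * n * hammingDist f g := by
  have hsum : ∑ v, (if f v ≠ g v then (1 : ℝ) else 0) = hammingDist f g := by
    rw [hammingDist, Finset.sum_boole]
  have h : ∀ u v, |(if f u = f v then (1 : ℝ) else 0)
        * ((if P u = P v then 1 else 0) - 1 / (k : ℝ))
      - (if g u = g v then 1 else 0) * ((if P u = P v then 1 else 0) - 1 / (k : ℝ))|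
      ≤ (if f u ≠ g u then 1 else 0) + (if f v ≠ g v then 1 else 0) := by
    intro u v
    rw [← sub_mul, abs_mul]
    refine (mul_le_of_le_one_right (abs_nonneg _) (abs_ite_sub_inv_le_one _)).trans ?_
    by_cases hu : f u = g u <;> by_cases hv : f v = g v
    · simp [hu, hv]
    all_goals
      simp only [hu, hv, ne_eq, not_true_eq_false, not_false_eq_true, if_true, if_false]
      split_ifs <;> norm_num
  rw [score, score, ← Finset.sum_sub_distrib]
  simp_rw [← Finset.sum_sub_distrib]
  calc _ ≤ ∑ u, ∑ v, ((if f u ≠ g u then (1 : ℝ) else 0) + (if f v ≠ g v then 1 else 0)) :=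
        (Finset.abs_sum_le_sum_abs _ _).trans (Finset.sum_le_sum fun u _ =>
          (Finset.abs_sum_le_sum_abs _ _).trans (Finset.sum_le_sum fun v _ => h u v))
    _ = 2 * n * hammingDist f g := by
        simp_rw [Finset.sum_add_distrib, hsum, Finset.sum_const, ← Finset.smul_sum, hsum]
        simp
        ring

lemma sum_ite_eq_card_part {n k : ℕ} (P : Fin n → Fin k) (j : Fin k) :
    ∑ u, (if P u = j then (1 : ℝ) else 0) = (part P j).card := by
  rw [part, Finset.sum_boole]

/-- The contribution to the linear part of the score at `P` of relabelling `v` from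
`P v` to `f v`. -/
def linTerm {n k : ℕ} (P f : Fin n → Fin k) (v : Fin n) : ℝ :=
  ∑ u, ((if P u = f v then 1 else 0) - (if P u = P v then 1 else 0))
    * ((if P u = P v then 1 else 0) - 1 / (k : ℝ))

/-- The contribution to the quadratic part of the score at `P` of relabelling both `u`
and `v`. -/
def quadTerm {n k : ℕ} (P f : Fin n → Fin k) (u v : Fin n) : ℝ :=
  ((if f u = f v then 1 else 0) - (if P u = f v then 1 else 0) - (if f u = P v then 1 else 0)
    + (if P u = P v then 1 else 0)) * ((if P u = P v then 1 else 0) - 1 / (k : ℝ))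

/-- Second-order expansion of the score at `P`. -/
lemma score_eq {n k : ℕ} (P f : Fin n → Fin k) :
    score P f = score P P + 2 * ∑ v, linTerm P f v + ∑ u, ∑ v, quadTerm P f u v := by
  have h1 : ∑ v, linTerm P f v = ∑ u, ∑ v,
      ((if P u = f v then (1 : ℝ) else 0) - (if P u = P v then 1 else 0))
        * ((if P u = P v then 1 else 0) - 1 / (k : ℝ)) := Finset.sum_comm
  have h2 : ∑ v, linTerm P f v = ∑ u, ∑ v,
      ((if f u = P v then (1 : ℝ) else 0) - (if P u = P v then 1 else 0))
        * ((if P u = P v then 1 else 0) - 1 / (k : ℝ)) := by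
    refine Finset.sum_congr rfl fun u _ => Finset.sum_congr rfl fun v _ => ?_
    simp only [eq_comm (a := P v)]
  rw [two_mul]
  nth_rw 1 [h1]
  rw [h2, score, score]
  simp_rw [← Finset.sum_add_distrib]
  refine Finset.sum_congr rfl fun u _ => Finset.sum_congr rfl fun v _ => ?_
  rw [quadTerm]
  ring

lemma linTerm_of_eq {n k : ℕ} {P f : Fin n → Fin k} {v : Fin n} (h : f v = P v) :
    linTerm P f v = 0 := by
  simp [linTerm, h]

lemma linTerm_of_ne {n k : ℕ} {P f : Fin n → Fin k} {v : Fin n} (h : f v ≠ P v) :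
    linTerm P f v
      = -((1 - 1 / (k : ℝ)) * (part P (P v)).card + 1 / (k : ℝ) * (part P (f v)).card) := by
  rw [linTerm, ← sum_ite_eq_card_part, ← sum_ite_eq_card_part, Finset.mul_sum, Finset.mul_sum,
    ← Finset.sum_add_distrib, ← Finset.sum_neg_distrib]
  refine Finset.sum_congr rfl fun u _ => ?_
  by_cases h1 : P u = P v
  · have h2 : P u ≠ f v := fun h2 => h (h2.symm.trans h1)
    simp only [h1, if_true]
    rw [if_neg h.symm]
    ring
  · simp only [h1, if_false]
    ring

lemma quadTerm_of_eq {n k : ℕ} {P f : Fin n → Fin k} {u v : Fin n}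
    (h : f u = P u ∨ f v = P v) : quadTerm P f u v = 0 := by
  rcases h with h | h <;> rw [quadTerm, h] <;> ring

lemma quadTerm_le {n k : ℕ} (hk : 2 ≤ k) (P f : Fin n → Fin k) (u v : Fin n) :
    quadTerm P f u v ≤ 2 * (1 - 1 / (k : ℝ)) := by
  have h0 : (0 : ℝ) ≤ 1 / k := by positivity
  have h1 : 1 / (k : ℝ) ≤ 1 / 2 := by
    have : (2 : ℝ) ≤ k := by exact_mod_cast hk
    gcongr
  rw [quadTerm]
  by_cases hP : P u = P v
  · simp only [hP, if_true]
    split_ifs <;> nlinarith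
  · simp only [hP, if_false]
    split_ifs <;> nlinarith

lemma IsBalanced.bounds {n k : ℕ} {P : Fin n → Fin k} (hP : IsBalanced P) (i : Fin k) :
    (n : ℝ) / k - 1 ≤ (part P i).card ∧ ((part P i).card : ℝ) ≤ (n : ℝ) / k + 1 := by
  obtain ⟨h1, h2⟩ := hP i
  have h3 := Nat.lt_floor_add_one ((n : ℝ) / k)
  have h4 := Nat.ceil_lt_add_one (show (0 : ℝ) ≤ (n : ℝ) / k by positivity)
  have h1' : (⌊(n : ℝ) / k⌋₊ : ℝ) ≤ (part P i).card := by exact_mod_cast h1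
  have h2' : ((part P i).card : ℝ) ≤ ⌈(n : ℝ) / k⌉₊ := by exact_mod_cast h2
  constructor <;> linarith

lemma sum_ite_ne {n k : ℕ} (P f : Fin n → Fin k) :
    ∑ v, (if P v ≠ f v then (1 : ℝ) else 0) = hammingDist P f := by
  rw [hammingDist, Finset.sum_boole]

lemma inv_nat_le_one (k : ℕ) : 1 / (k : ℝ) ≤ 1 := by
  rw [one_div]
  exact Nat.cast_inv_le_one k

lemma sum_linTerm_le {n k : ℕ} {P : Fin n → Fin k} (hP : IsBalanced P) (f : Fin n → Fin k) :
    ∑ v, linTerm P f v ≤ -((n : ℝ) / k - 1) * hammingDist P f := by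
  rw [← sum_ite_ne, Finset.mul_sum]
  refine Finset.sum_le_sum fun v _ => ?_
  by_cases h : f v = P v
  · simp [linTerm_of_eq h, h]
  · rw [linTerm_of_ne h, if_pos (Ne.symm h)]
    have h1 := (hP.bounds (P v)).1
    have h2 := (hP.bounds (f v)).1
    have h0 : (0 : ℝ) ≤ 1 / k := by positivity
    nlinarith [inv_nat_le_one k]

lemma le_sum_linTerm {n k : ℕ} {P : Fin n → Fin k} (hP : IsBalanced P) (f : Fin n → Fin k) :
    -((n : ℝ) / k + 1) * hammingDist P f ≤ ∑ v, linTerm P f v := by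
  rw [← sum_ite_ne, Finset.mul_sum]
  refine Finset.sum_le_sum fun v _ => ?_
  by_cases h : f v = P v
  · simp [linTerm_of_eq h, h]
  · rw [linTerm_of_ne h, if_pos (Ne.symm h)]
    have h1 := (hP.bounds (P v)).2
    have h2 := (hP.bounds (f v)).2
    have h0 : (0 : ℝ) ≤ 1 / k := by positivity
    nlinarith [inv_nat_le_one k]

lemma sum_quadTerm_le {n k : ℕ} (hk : 2 ≤ k) (P f : Fin n → Fin k) :
    ∑ u, ∑ v, quadTerm P f u v ≤ 2 * (1 - 1 / (k : ℝ)) * (hammingDist P f : ℝ) ^ 2 := by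
  rw [sq, ← sum_ite_ne, Finset.sum_mul_sum, Finset.mul_sum]
  refine Finset.sum_le_sum fun u _ => ?_
  rw [Finset.mul_sum]
  refine Finset.sum_le_sum fun v _ => ?_
  by_cases hu : f u = P u
  · simp [quadTerm_of_eq (Or.inl hu), hu]
  by_cases hv : f v = P v
  · simp [quadTerm_of_eq (Or.inr hv), hv]
  rw [if_pos (Ne.symm hu), if_pos (Ne.symm hv), mul_one, mul_one]
  exact quadTerm_le hk P f u v

/-- Upper bound for the score of a partition in terms of its distance to `P`, attained to first
order by moving vertices from one community to one other. -/
lemma score_le {n k : ℕ} (hk : 2 ≤ k) {P : Fin n → Fin k} (hP : IsBalanced P)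
    (f : Fin n → Fin k) :
    score P f ≤ score P P - 2 * ((n : ℝ) / k - 1) * hammingDist P f
      + 2 * (1 - 1 / (k : ℝ)) * (hammingDist P f : ℝ) ^ 2 := by
  rw [score_eq]
  linarith [sum_linTerm_le hP f, sum_quadTerm_le hk P f]

/-- The labelling obtained from `P` by merging the part `i` into the part `j`. -/
def merge {n k : ℕ} (P : Fin n → Fin k) (i j : Fin k) (v : Fin n) : Fin k :=
  if P v = i then j else P v

lemma merge_ne {n k : ℕ} (P : Fin n → Fin k) {i j : Fin k} (hij : i ≠ j) (v : Fin n) :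
    merge P i j v ≠ i := by
  rw [merge]
  split_ifs with h
  · exact hij.symm
  · exact h

lemma ne_merge_iff {n k : ℕ} (P : Fin n → Fin k) {i j : Fin k} (hij : i ≠ j) (v : Fin n) :
    P v ≠ merge P i j v ↔ P v = i := by
  rw [merge]
  split_ifs with h
  · simp [h, hij]
  · simp [h]

lemma hammingDist_merge {n k : ℕ} (P : Fin n → Fin k) {i j : Fin k} (hij : i ≠ j) :
    hammingDist P (merge P i j) = (part P i).card := by
  simp_rw [hammingDist, part, ne_merge_iff P hij]

lemma le_score_merge {n k : ℕ} {P : Fin n → Fin k} (hP : IsBalanced P) {i j : Fin k}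
    (hij : i ≠ j) :
    score P P - 2 * ((n : ℝ) / k + 1) * (part P i).card
      + 2 * (1 - 1 / (k : ℝ)) * ((part P i).card : ℝ) ^ 2 ≤ score P (merge P i j) := by
  have hq : ∑ u, ∑ v, quadTerm P (merge P i j) u v
      = 2 * (1 - 1 / (k : ℝ)) * ((part P i).card : ℝ) ^ 2 := by
    rw [sq, ← sum_ite_eq_card_part, Finset.sum_mul_sum, Finset.mul_sum]
    refine Finset.sum_congr rfl fun u _ => ?_
    rw [Finset.mul_sum]
    refine Finset.sum_congr rfl fun v _ => ?_
    by_cases hu : P u = i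
    · by_cases hv : P v = i
      · simp only [quadTerm, merge, hu, hv, if_true, if_neg hij, if_neg hij.symm]
        ring
      · rw [quadTerm_of_eq (Or.inr (by simp [merge, hv]))]
        simp [hv]
    · rw [quadTerm_of_eq (Or.inl (by simp [merge, hu]))]
      simp [hu]
  have h := le_sum_linTerm hP (merge P i j)
  rw [hammingDist_merge P hij] at h
  rw [score_eq P (merge P i j), hq]
  linarith

/-- The profile `-2 t / k + 2 (1 - 1/k) t²`: up to `O(1/n)`, an upper bound for the change of the
normalised score at distance `t` from `P`. It is decreasing up to `t = 1 / (2 (k - 1))` and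
increasing from there. -/
def profile (k : ℕ) (t : ℝ) : ℝ := -2 * t / k + 2 * (1 - 1 / (k : ℝ)) * t ^ 2

lemma profile_sub_profile {k : ℕ} (hk : 2 ≤ k) (s t : ℝ) :
    profile k t - profile k s = 2 * (1 - 1 / (k : ℝ)) *
      ((t - s) * ((s - 1 / (2 * ((k : ℝ) - 1))) + (t - 1 / (2 * ((k : ℝ) - 1))))) := by
  have hk' : (2 : ℝ) ≤ k := by exact_mod_cast hk
  have hk1 : (k : ℝ) - 1 ≠ 0 := by linarith
  rw [profile, profile]
  field_simp
  ring

lemma profile_le_profile {k : ℕ} (hk : 2 ≤ k) {s t : ℝ} (hs : 1 / (2 * ((k : ℝ) - 1)) ≤ s)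
    (hst : s ≤ t) : profile k s ≤ profile k t := by
  rw [← sub_nonneg, profile_sub_profile hk]
  have h := inv_nat_le_one k
  exact mul_nonneg (by linarith) (mul_nonneg (by linarith) (by linarith))

lemma profile_lt_profile {k : ℕ} (hk : 2 ≤ k) {s t : ℝ} (hs : 1 / (2 * ((k : ℝ) - 1)) < s)
    (hst : s < t) : profile k s < profile k t := by
  rw [← sub_pos, profile_sub_profile hk]
  have hk' : (2 : ℝ) ≤ k := by exact_mod_cast hk
  have h : 1 / (k : ℝ) ≤ 1 / 2 := by gcongr
  exact mul_pos (by linarith) (mul_pos (by linarith) (by linarith))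

/-- The energy barrier: all partitions at distance between `1 / (2 (k - 1))` and `ν` from `P` have
a score that is smaller, by a constant times `n²`, than the score of the partition in which two
communities are merged, which is at distance at least `ν`. -/
lemma exists_score_gap {k : ℕ} (hk : 3 ≤ k) {ν : ℝ} (hν₁ : 1 / (2 * ((k : ℝ) - 1)) < ν)
    (hν₂ : ν < 1 / (k : ℝ)) :
    ∃ γ > (0 : ℝ), ∃ n₀ : ℕ, ∀ n ≥ n₀, ∀ P : Fin n → Fin k, IsBalanced P →
      ∃ g : Fin n → Fin k, ν ≤ distance (KPartition.mk P) (KPartition.mk g) ∧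
        ∀ f : Fin n → Fin k, 1 / (2 * ((k : ℝ) - 1)) ≤ (hammingDist P f : ℝ) / n →
          (hammingDist P f : ℝ) / n ≤ ν → score P f + γ * n ^ 2 ≤ score P g := by
  have hk2 : 2 ≤ k := by omega
  have hk' : (3 : ℝ) ≤ k := by exact_mod_cast hk
  have hgap := profile_lt_profile hk2 hν₁ hν₂
  set γ₀ := profile k (1 / k) - profile k ν with hγ₀
  have hγpos : 0 < γ₀ := by rw [hγ₀]; linarith
  obtain ⟨n₁, hn₁⟩ := exists_nat_gt (20 / γ₀)
  obtain ⟨n₂, hn₂⟩ := exists_nat_gt (1 / (1 / (k : ℝ) - ν))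
  refine ⟨γ₀ / 2, by linarith, max (max n₁ n₂) 1, fun n hn P hP => ?_⟩
  have hn0 : 0 < n := by
    have : 1 ≤ n := le_trans (le_max_right _ _) hn
    omega
  have hn1 : n₁ ≤ n := le_trans (le_trans (le_max_left _ _) (le_max_left _ _)) hn
  have hn2 : n₂ ≤ n := le_trans (le_trans (le_max_right _ _) (le_max_left _ _)) hn
  have hnR : (0 : ℝ) < n := by exact_mod_cast hn0
  have hn1' : 20 / γ₀ < n := hn₁.trans_le (by exact_mod_cast hn1)
  have hn2' : 1 / (1 / (k : ℝ) - ν) < n := hn₂.trans_le (by exact_mod_cast hn2)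
  rw [div_lt_iff₀ hγpos] at hn1'
  rw [div_lt_iff₀ (by linarith)] at hn2'
  set i : Fin k := ⟨0, by omega⟩
  set j : Fin k := ⟨1, by omega⟩
  have hij : i ≠ j := by simp [i, j]
  refine ⟨merge P i j, ?_, fun f hf₁ hf₂ => ?_⟩
  · refine le_trans ?_ (le_distance_of_unused_label hn0 P (merge P i j) i (merge_ne P hij)
      ⌊(n : ℝ) / k⌋₊ fun l => (hP l).1)
    rw [le_div_iff₀ hnR]
    have h1 := Nat.lt_floor_add_one ((n : ℝ) / k)
    have h2 : (n : ℝ) / k = n * (1 / k) := by ring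
    nlinarith
  · have h1 := score_le hk2 hP f
    have h2 := le_score_merge hP hij
    obtain ⟨hm1, hm2⟩ := hP.bounds i
    set M : ℝ := (hammingDist P f : ℝ)
    set m : ℝ := ((part P i).card : ℝ)
    have hφ := profile_le_profile hk2 hf₁ hf₂
    have hMn : M ≤ n := by
      have : hammingDist P f ≤ n := by simpa using hammingDist_le_card_fintype (x := P) (y := f)
      exact Nat.cast_le.2 this
    have hmn : m ≤ n := by
      have : (part P i).card ≤ n := by simpa using Finset.card_le_univ (part P i)
      exact Nat.cast_le.2 this
    have hm0 : 0 ≤ m := by positivity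
    have hkinv : 1 / (k : ℝ) ≤ 1 / 3 := by gcongr
    have hkinv0 : (0 : ℝ) < 1 / k := by positivity
    have eM : profile k (M / n) * n ^ 2
        = -2 * ((n : ℝ) / k) * M + 2 * (1 - 1 / (k : ℝ)) * M ^ 2 := by
      rw [profile]
      field_simp
    have em : -2 * ((n : ℝ) / k) * m + 2 * (1 - 1 / (k : ℝ)) * m ^ 2
        = profile k (1 / k) * n ^ 2
          + (m - n / k) * (-2 * (n / k) + 2 * (1 - 1 / (k : ℝ)) * (m + n / k)) := by
      rw [profile]
      field_simp
      ring
    have hφn : profile k (M / n) * n ^ 2 ≤ profile k ν * n ^ 2 := by gcongr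
    have hnk : (n : ℝ) / k ≤ n := div_le_self hnR.le (by linarith)
    have hnk0 : (0 : ℝ) ≤ n / k := by positivity
    -- Replacing `m` by `n / k` costs `O(n)`.
    have herr : -(6 * (n : ℝ))
        ≤ (m - n / k) * (-2 * (n / k) + 2 * (1 - 1 / (k : ℝ)) * (m + n / k)) := by
      refine neg_le_of_abs_le ?_
      rw [abs_mul]
      have ha : |m - n / k| ≤ 1 := by rw [abs_le]; constructor <;> linarith
      have hb : |-2 * ((n : ℝ) / k) + 2 * (1 - 1 / (k : ℝ)) * (m + n / k)| ≤ 6 * n := by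
        rw [abs_le]
        have : 0 ≤ (1 - 1 / (k : ℝ)) * (m + n / k) := mul_nonneg (by linarith) (by linarith)
        have : (1 - 1 / (k : ℝ)) * (m + n / k) ≤ 1 * (m + n / k) :=
          mul_le_mul_of_nonneg_right (by linarith) (by linarith)
        constructor <;> linarith
      calc _ ≤ 1 * (6 * (n : ℝ)) := mul_le_mul ha hb (abs_nonneg _) zero_le_one
        _ = 6 * n := one_mul _
    have h20 : 10 * (n : ℝ) ≤ γ₀ / 2 * n ^ 2 := by nlinarith
    have hdef : profile k (1 / k) * (n : ℝ) ^ 2 = profile k ν * n ^ 2 + γ₀ * n ^ 2 := by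
      rw [hγ₀]; ring
    linarith

/-! ### Modularity through linear forms in the adjacency matrix -/

open Classical in
/-- The entries of the adjacency matrix. -/
def adj {n : ℕ} (G : SimpleGraph (Fin n)) (u v : Fin n) : ℝ := if G.Adj u v then 1 else 0

/-- The coefficients of the linear forms in the adjacency matrix that determine the modularity of
`f`: twice the number of edges inside parts (for `none`), and the total degree of the part `i`
(for `some i`). The coefficients are symmetric in the two vertices. -/
def coef {n k : ℕ} (f : Fin n → Fin k) : Option (Fin k) → Fin n → Fin n → ℝ
  | none, u, v => if f u = f v then 1 else 0
  | some i, u, v => ((if f u = i then 1 else 0) + (if f v = i then 1 else 0)) / 2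

/-- The linear form with coefficients `coef f o` in a matrix `x`. -/
def form {n k : ℕ} (f : Fin n → Fin k) (o : Option (Fin k)) (x : Fin n → Fin n → ℝ) : ℝ :=
  ∑ u, ∑ v, coef f o u v * x u v

lemma coef_symm {n k : ℕ} (f : Fin n → Fin k) (o : Option (Fin k)) (u v : Fin n) :
    coef f o u v = coef f o v u := by
  cases o with
  | none => simp only [coef, eq_comm]
  | some i => simp only [coef, add_comm]

lemma abs_coef_le_one {n k : ℕ} (f : Fin n → Fin k) (o : Option (Fin k)) (u v : Fin n) :
    |coef f o u v| ≤ 1 := by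
  rw [abs_le]
  cases o <;> simp only [coef] <;> split_ifs <;> norm_num

lemma form_some {n k : ℕ} (f : Fin n → Fin k) (i : Fin k) {x : Fin n → Fin n → ℝ}
    (hx : ∀ u v, x u v = x v u) :
    form f (some i) x = ∑ u, (if f u = i then 1 else 0) * ∑ v, x u v := by
  have h : ∑ u, ∑ v, (if f v = i then (1 : ℝ) else 0) * x u v
      = ∑ u, (if f u = i then 1 else 0) * ∑ v, x u v := by
    rw [Finset.sum_comm]
    refine Finset.sum_congr rfl fun u _ => ?_
    rw [Finset.mul_sum]
    exact Finset.sum_congr rfl fun v _ => by rw [hx]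
  have h2 : form f (some i) x
      = (∑ u, (if f u = i then 1 else 0) * ∑ v, x u v
        + ∑ u, ∑ v, (if f v = i then (1 : ℝ) else 0) * x u v) / 2 := by
    rw [form, ← Finset.sum_add_distrib, Finset.sum_div]
    refine Finset.sum_congr rfl fun u _ => ?_
    rw [Finset.mul_sum, ← Finset.sum_add_distrib, Finset.sum_div]
    refine Finset.sum_congr rfl fun v _ => ?_
    rw [coef]
    ring
  rw [h2, h]
  ring

lemma form_sub {n k : ℕ} (f : Fin n → Fin k) (o : Option (Fin k)) (x y : Fin n → Fin n → ℝ) :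
    form f o (fun u v => x u v - y u v) = form f o x - form f o y := by
  simp only [form, mul_sub, Finset.sum_sub_distrib]

lemma adj_symm {n : ℕ} (G : SimpleGraph (Fin n)) (u v : Fin n) : adj G u v = adj G v u := by
  by_cases h : G.Adj u v
  · rw [adj, adj, if_pos h, if_pos h.symm]
  · rw [adj, adj, if_neg h, if_neg fun h' => h h'.symm]

open Classical in
lemma sum_adj {n : ℕ} (G : SimpleGraph (Fin n)) (u : Fin n) :
    ∑ v, adj G u v = G.degree u := by
  simp only [adj]
  rw [Finset.sum_boole, ← G.card_neighborFinset_eq_degree]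
  congr 2
  ext v
  simp

open Classical in
lemma sum_sum_adj {n : ℕ} (G : SimpleGraph (Fin n)) :
    ∑ u, ∑ v, adj G u v = 2 * G.edgeFinset.card := by
  simp_rw [sum_adj]
  exact_mod_cast G.sum_degrees_eq_twice_card_edges

lemma form_const {n k : ℕ} (i : Fin k) (x : Fin n → Fin n → ℝ) :
    form (fun _ => i) (some i) x = ∑ u, ∑ v, x u v := by
  simp [form, coef]

lemma sum_part {n k : ℕ} (f : Fin n → Fin k) (x : Fin n → Fin n → ℝ) :
    ∑ i, ∑ u ∈ part f i, ∑ v ∈ part f i, x u v = form f none x := by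
  rw [form, ← Finset.sum_fiberwise_of_maps_to (s := Finset.univ) (t := Finset.univ) (g := f)
    (by simp)]
  refine Finset.sum_congr rfl fun i _ => Finset.sum_congr rfl fun u hu => ?_
  have hu' : f u = i := by simpa [part] using hu
  rw [part, Finset.sum_filter]
  refine Finset.sum_congr rfl fun v _ => ?_
  simp only [coef, hu', eq_comm (a := i)]
  split_ifs <;> simp

/-- Modularity in terms of the linear forms; `form (fun _ => i₀) (some i₀) (adj G)` is the total
degree `2 m`. -/
lemma modularityLabelled_eq {n k : ℕ} (G : SimpleGraph (Fin n)) (f : Fin n → Fin k)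
    (i₀ : Fin k) :
    modularityLabelled G f
      = form f none (adj G) / form (fun _ => i₀) (some i₀) (adj G)
        - ∑ i, (form f (some i) (adj G) / form (fun _ => i₀) (some i₀) (adj G)) ^ 2 := by
  classical
  rw [form_const, sum_sum_adj]
  set m : ℝ := 2 * G.edgeFinset.card with hm
  have h1 : modularityLabelled G f = 1 / m * ∑ i, ∑ u ∈ part f i, ∑ v ∈ part f i,
      (adj G u v - (G.degree u : ℝ) * (G.degree v : ℝ) / m) := by
    rw [modularityLabelled, hm]
    rfl
  have h2 : ∀ i, form f (some i) (adj G) = ∑ u ∈ part f i, (G.degree u : ℝ) := by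
    intro i
    rw [form_some f i (adj_symm G), part, Finset.sum_filter]
    refine Finset.sum_congr rfl fun u _ => ?_
    rw [sum_adj]
    split_ifs <;> simp
  rw [h1, ← sum_part]
  simp_rw [Finset.sum_sub_distrib, h2]
  rw [mul_sub]
  congr 1
  · ring
  · rw [Finset.mul_sum]
    refine Finset.sum_congr rfl fun i _ => ?_
    simp_rw [← Finset.sum_div]
    rw [← Finset.sum_mul_sum, div_pow]
    ring

/-- Stability of `e / m - ∑ (v_i / m)²` under perturbations of size `h`. -/
lemma abs_ratio_sub_le {k : ℕ} {e α a m s h : ℝ} {v y : Fin k → ℝ} (hs : 0 < s)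
    (hh : h ≤ s / 2) (hα : |α| ≤ a) (hy0 : ∀ i, 0 ≤ y i) (hy1 : ∀ i, y i ≤ 1)
    (he : |e - α| ≤ h) (hm : |m - s| ≤ h) (hv : ∀ i, |v i - s * y i| ≤ h) :
    |(e / m - ∑ i, (v i / m) ^ 2) - (α / s - ∑ i, y i ^ 2)|
      ≤ h * (2 / s + 2 * a / s ^ 2 + 16 * k / s) := by
  have h0 : 0 ≤ h := (abs_nonneg _).trans he
  have hms : s / 2 ≤ m := by linarith [(abs_le.1 hm).1]
  have hmpos : 0 < m := by linarith
  have hinv : 1 / m ≤ 2 / s := by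
    rw [div_le_div_iff₀ hmpos hs]
    linarith
  have h1 : |e / m - α / s| ≤ h * (2 / s + 2 * a / s ^ 2) := by
    have e1 : e / m - α / s = (e - α) * (1 / m) + α / s * ((s - m) * (1 / m)) := by
      field_simp
      ring
    have hb : |(s - m) * (1 / m)| ≤ h * (2 / s) := by
      rw [abs_mul, abs_sub_comm, abs_of_pos (show 0 < 1 / m by positivity)]
      gcongr
    have ha : |(e - α) * (1 / m)| ≤ h * (2 / s) := by
      rw [abs_mul, abs_of_pos (show 0 < 1 / m by positivity)]
      gcongr
    have hc : |α / s * ((s - m) * (1 / m))| ≤ a / s * (h * (2 / s)) := by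
      have ha0 : 0 ≤ a := (abs_nonneg α).trans hα
      rw [abs_mul, abs_div, abs_of_pos hs]
      gcongr
    rw [e1]
    refine (abs_add_le _ _).trans ((add_le_add ha hc).trans (le_of_eq ?_))
    field_simp
  have h2 : ∀ i, |(v i / m) ^ 2 - y i ^ 2| ≤ 16 * h / s := by
    intro i
    have e1 : v i / m - y i = (v i - s * y i) * (1 / m) + y i * ((s - m) * (1 / m)) := by
      field_simp
      ring
    have hd : |v i / m - y i| ≤ 4 * h / s := by
      have ha : |(v i - s * y i) * (1 / m)| ≤ h * (2 / s) := by
        rw [abs_mul, abs_of_pos (show 0 < 1 / m by positivity)]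
        gcongr
        exact hv i
      have hb : |y i * ((s - m) * (1 / m))| ≤ 1 * (h * (2 / s)) := by
        rw [abs_mul, abs_mul, abs_sub_comm s, abs_of_nonneg (hy0 i),
          abs_of_pos (show 0 < 1 / m by positivity)]
        gcongr
        exact hy1 i
      rw [e1]
      refine (abs_add_le _ _).trans ((add_le_add ha hb).trans (le_of_eq ?_))
      ring
    have hd2 : 4 * h / s ≤ 2 := by
      rw [div_le_iff₀ hs]
      linarith
    have hsum : |v i / m + y i| ≤ 4 := by
      have := abs_le.1 hd
      have := hy0 i
      have := hy1 i
      rw [abs_le]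
      constructor <;> linarith
    rw [sq_sub_sq, abs_mul]
    calc _ ≤ 4 * (4 * h / s) := mul_le_mul hsum hd (abs_nonneg _) (by norm_num)
      _ = _ := by ring
  have h3 : |∑ i, (v i / m) ^ 2 - ∑ i, y i ^ 2| ≤ k * (16 * h / s) := by
    rw [← Finset.sum_sub_distrib]
    refine (Finset.abs_sum_le_sum_abs _ _).trans ?_
    refine (Finset.sum_le_card_nsmul _ _ _ fun i _ => h2 i).trans (le_of_eq ?_)
    simp
  have e2 : (e / m - ∑ i, (v i / m) ^ 2) - (α / s - ∑ i, y i ^ 2)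
      = (e / m - α / s) - (∑ i, (v i / m) ^ 2 - ∑ i, y i ^ 2) := by ring
  rw [e2]
  refine (abs_sub _ _).trans ((add_le_add h1 h3).trans (le_of_eq ?_))
  ring

/-! ### Expected values of the linear forms -/

/-- The edge probabilities, with a zero diagonal. -/
def edgeProb {n k : ℕ} (P : Fin n → Fin k) (p q : ℝ) (u v : Fin n) : ℝ :=
  if u = v then 0 else if P u = P v then p else q

lemma edgeProb_symm {n k : ℕ} (P : Fin n → Fin k) (p q : ℝ) (u v : Fin n) :
    edgeProb P p q u v = edgeProb P p q v u := by
  simp only [edgeProb, eq_comm]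

lemma edgeProb_eq {n k : ℕ} (P : Fin n → Fin k) (p q : ℝ) (u v : Fin n) :
    edgeProb P p q u v
      = (p - q) * (if P u = P v then 1 else 0) + q - p * (if u = v then 1 else 0) := by
  rw [edgeProb]
  by_cases h : u = v
  · simp [h]
  · simp only [h, if_false]
    split_ifs <;> ring

lemma form_none_edgeProb {n k : ℕ} (P f : Fin n → Fin k) (p q : ℝ) :
    form f none (edgeProb P p q)
      = (p - q) * ∑ u, ∑ v, (if f u = f v then 1 else 0) * (if P u = P v then 1 else 0)
        + q * ∑ u, ∑ v, (if f u = f v then 1 else 0) - p * n := by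
  have h : ∀ u v : Fin n, coef f none u v * edgeProb P p q u v
      = (p - q) * ((if f u = f v then 1 else 0) * (if P u = P v then 1 else 0))
        + q * (if f u = f v then 1 else 0) - p * (if u = v then 1 else 0) := by
    intro u v
    rw [edgeProb_eq, coef]
    by_cases huv : u = v
    · simp [huv]
    · simp only [huv, if_false]
      ring
  simp only [form, h, Finset.sum_add_distrib, Finset.sum_sub_distrib, ← Finset.mul_sum]
  simp

lemma sum_edgeProb {n k : ℕ} (P : Fin n → Fin k) (p q : ℝ) (u : Fin n) :
    ∑ v, edgeProb P p q u v = (p - q) * (part P (P u)).card + q * n - p := by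
  simp only [edgeProb_eq, Finset.sum_add_distrib, Finset.sum_sub_distrib, ← Finset.mul_sum]
  rw [← sum_ite_eq_card_part]
  simp [eq_comm, mul_comm]

lemma sum_sum_ite_eq {n k : ℕ} (f : Fin n → Fin k) :
    ∑ u, ∑ v, (if f u = f v then (1 : ℝ) else 0) = ∑ i, ((part f i).card : ℝ) ^ 2 := by
  have h := sum_part f fun _ _ => 1
  simp only [form, coef, mul_one] at h
  rw [← h]
  refine Finset.sum_congr rfl fun i _ => ?_
  simp [sq]

lemma score_eq_sub {n k : ℕ} (P f : Fin n → Fin k) :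
    score P f = ∑ u, ∑ v, (if f u = f v then 1 else 0) * (if P u = P v then 1 else 0)
      - 1 / (k : ℝ) * ∑ u, ∑ v, (if f u = f v then 1 else 0) := by
  simp only [score, mul_sub, Finset.sum_sub_distrib, Finset.mul_sum, mul_comm]

/-- The expected total degree of a part is proportional to its size, up to `O(1)`. -/
lemma abs_form_some_edgeProb_sub_le {n k : ℕ} (hn : 0 < n) {P : Fin n → Fin k}
    (hP : IsBalanced P) {a b ω : ℝ} (hb : 0 < b) (hab : b < a) (hω : 0 < ω)
    (f : Fin n → Fin k) (i : Fin k) :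
    |form f (some i) (edgeProb P (ω * a / n) (ω * b / n))
      - ω * ((a + (k - 1) * b) / k) * (part f i).card| ≤ ω * (2 * a) := by
  have hnR : (0 : ℝ) < n := by exact_mod_cast hn
  have hk : (0 : ℝ) < k := by
    have := i.pos
    exact_mod_cast this
  rw [form_some f i (edgeProb_symm P _ _), ← sum_ite_eq_card_part, Finset.mul_sum,
    ← Finset.sum_sub_distrib]
  have h : ∀ u : Fin n, |(if f u = i then (1 : ℝ) else 0)
        * ∑ v, edgeProb P (ω * a / n) (ω * b / n) u v
      - ω * ((a + (k - 1) * b) / k) * (if f u = i then 1 else 0)| ≤ ω * (2 * a) / n := by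
    intro u
    have hpos : 0 ≤ ω * (2 * a) / n := by
      have : 0 < a := hb.trans hab
      positivity
    split_ifs
    swap
    · simpa using hpos
    obtain ⟨h1, h2⟩ := hP.bounds (P u)
    have e : 1 * ∑ v, edgeProb P (ω * a / n) (ω * b / n) u v - ω * ((a + (k - 1) * b) / k) * 1
        = ω / n * ((a - b) * ((part P (P u)).card - n / k) - a) := by
      rw [sum_edgeProb]
      field_simp
      ring
    have h3 : |(a - b) * ((part P (P u)).card - n / k) - a| ≤ 2 * a := by
      rw [abs_le]
      constructor <;> nlinarith
    rw [e, abs_mul, abs_of_pos (by positivity)]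
    calc _ ≤ ω / n * (2 * a) := by gcongr
      _ = _ := by ring
  refine (Finset.abs_sum_le_sum_abs _ _).trans
    ((Finset.sum_le_card_nsmul _ _ _ fun u _ => h u).trans (le_of_eq ?_))
  simp
  field_simp

/-- If all the linear forms are close to their expected values, then the modularity of every
labelling is close to a multiple of its score. -/
lemma abs_modularityLabelled_sub_score_le {n k : ℕ} (hn : 0 < n) (i₀ : Fin k)
    {P : Fin n → Fin k}
    (hP : IsBalanced P) {a b ω η : ℝ} (hb : 0 < b) (hab : b < a) (hω : 0 < ω)
    {G : SimpleGraph (Fin n)}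
    (hG : ∀ (f : Fin n → Fin k) (o : Option (Fin k)),
      |form f o (fun u v => adj G u v - edgeProb P (ω * a / n) (ω * b / n) u v)| ≤ η * ω * n)
    (f : Fin n → Fin k) {s h : ℝ} (hs : s = (a + (k - 1) * b) / k) (hh : h = η + 2 * a / n)
    (hhs : h ≤ s / 2) :
    |modularityLabelled G f - (a - b) / s * (score P f / n ^ 2)|
      ≤ h * (2 / s + 2 * a / s ^ 2 + 16 * k / s) := by
  have hnR : (0 : ℝ) < n := by exact_mod_cast hn
  have ha : 0 < a := hb.trans hab
  have hk : (1 : ℝ) ≤ k := by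
    have := i₀.pos
    exact_mod_cast this
  have hk0 : (0 : ℝ) < k := by linarith
  have hspos : 0 < s := by
    rw [hs]
    have : 0 ≤ ((k : ℝ) - 1) * b := mul_nonneg (by linarith) hb.le
    positivity
  have hωn : 0 < ω * n := by positivity
  set p := ω * a / n with hp
  set q := ω * b / n with hq
  set S₁ : ℝ := ∑ u, ∑ v, (if f u = f v then 1 else 0) * (if P u = P v then 1 else 0) with hS₁
  set S₂ : ℝ := ∑ u, ∑ v, (if f u = f v then 1 else 0) with hS₂
  have hcard : ∀ (g : Fin n → Fin k) (i : Fin k), ((part g i).card : ℝ) ≤ n := by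
    intro g i
    have : (part g i).card ≤ n := by simpa using Finset.card_le_univ (part g i)
    exact_mod_cast this
  have hS₁0 : 0 ≤ S₁ := Finset.sum_nonneg fun u _ => Finset.sum_nonneg fun v _ => by
    split_ifs <;> norm_num
  have hS₁₂ : S₁ ≤ S₂ := Finset.sum_le_sum fun u _ => Finset.sum_le_sum fun v _ => by
    split_ifs <;> norm_num
  have hS₂n : S₂ ≤ n ^ 2 := by
    calc S₂ ≤ ∑ _u : Fin n, ∑ _v : Fin n, (1 : ℝ) :=
          Finset.sum_le_sum fun u _ => Finset.sum_le_sum fun v _ => by split_ifs <;> norm_num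
      _ = n ^ 2 := by simp [sq]
  -- The degree forms, for an arbitrary labelling.
  have hvol : ∀ (g : Fin n → Fin k) (i : Fin k),
      |form g (some i) (adj G) / (ω * n) - s * ((part g i).card / n)| ≤ h := by
    intro g i
    have h1 := hG g (some i)
    rw [form_sub] at h1
    have h2 := abs_form_some_edgeProb_sub_le hn hP hb hab hω g i
    rw [← hs] at h2
    have e : form g (some i) (adj G) / (ω * n) - s * ((part g i).card / n)
        = (form g (some i) (adj G) - ω * s * (part g i).card) / (ω * n) := by
      field_simp
    rw [e, abs_div, abs_of_pos hωn, div_le_iff₀ hωn]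
    calc _ ≤ η * ω * n + ω * (2 * a) := by
          refine le_trans ?_ (add_le_add h1 h2)
          refine le_trans (le_of_eq ?_) (abs_add_le _ _)
          congr 1
          ring
      _ = _ := by rw [hh]; field_simp
  have hm := hvol (fun _ => i₀) i₀
  have hm1 : ((part (fun _ : Fin n => i₀) i₀).card : ℝ) / n = 1 := by
    simp [part, hnR.ne']
  rw [hm1, mul_one] at hm
  have he : |form f none (adj G) / (ω * n) - ((a - b) * (S₁ / n ^ 2) + b * (S₂ / n ^ 2))|
      ≤ h := by
    have h1 := hG f none
    rw [form_sub, form_none_edgeProb] at h1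
    have e : form f none (adj G) / (ω * n) - ((a - b) * (S₁ / n ^ 2) + b * (S₂ / n ^ 2))
        = ((form f none (adj G) - ((p - q) * S₁ + q * S₂ - p * n)) + -(ω * a)) / (ω * n) := by
      rw [hp, hq]
      field_simp
      ring
    rw [e, abs_div, abs_of_pos hωn, div_le_iff₀ hωn]
    calc _ ≤ η * ω * n + ω * a := by
          refine (abs_add_le _ _).trans (add_le_add h1 ?_)
          rw [abs_neg, abs_of_pos (by positivity)]
      _ ≤ η * ω * n + ω * (2 * a) := by nlinarith [mul_pos hω ha]
      _ = _ := by rw [hh]; field_simp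
  have hα : |(a - b) * (S₁ / n ^ 2) + b * (S₂ / n ^ 2)| ≤ a := by
    have hn2 : (0 : ℝ) < n ^ 2 := by positivity
    have h1 : S₁ / (n : ℝ) ^ 2 ≤ 1 := by rw [div_le_one hn2]; linarith
    have h2 : S₂ / (n : ℝ) ^ 2 ≤ 1 := by rw [div_le_one hn2]; linarith
    have h3 : 0 ≤ S₁ / (n : ℝ) ^ 2 := by positivity
    have h4 : 0 ≤ S₂ / (n : ℝ) ^ 2 := div_nonneg (by linarith) hn2.le
    rw [abs_le]
    constructor <;> nlinarith
  have hfinal := abs_ratio_sub_le (v := fun i => form f (some i) (adj G) / (ω * n))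
    (y := fun i => ((part f i).card : ℝ) / n) hspos hhs hα (fun i => by positivity)
    (fun i => by rw [div_le_one hnR]; exact hcard f i) he hm (fun i => hvol f i)
  rw [modularityLabelled_eq G f i₀]
  simp only [div_div_div_cancel_right₀ hωn.ne'] at hfinal
  refine le_trans (le_of_eq ?_) hfinal
  congr 2
  have hsq : ∑ i, (((part f i).card : ℝ) / n) ^ 2 = S₂ / n ^ 2 := by
    rw [hS₂, sum_sum_ite_eq, Finset.sum_div]
    simp_rw [div_pow]
  rw [hsq, score_eq_sub, ← hS₁, ← hS₂]
  have hsk : s * k = a + (k - 1) * b := by rw [hs]; field_simp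
  field_simp
  linear_combination S₂ * hsk

/-! ### Concentration -/

/-- Bernstein's bound for the moment generating function of a centred Bernoulli variable. -/
lemma integral_exp_bernoulli_le (p : unitInterval) {l : ℝ} (hl : |l| ≤ 1) :
    ∫ x, Real.exp (l * ((if x = true then 1 else 0) - (p : ℝ)))
      ∂bernoulliMeasure true false p ≤ Real.exp (p * l ^ 2) := by
  have hp0 := p.2.1
  have e : ∫ x, Real.exp (l * ((if x = true then 1 else 0) - (p : ℝ)))
      ∂bernoulliMeasure true false p
      = (p : ℝ) * Real.exp (l * (1 - p)) + (1 - p) * Real.exp (l * (0 - p)) := by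
    rw [bernoulliMeasure_def, integral_add_measure (Integrable.of_finite) (Integrable.of_finite),
      integral_smul_nnreal_measure, integral_smul_nnreal_measure, integral_dirac, integral_dirac]
    simp [NNReal.smul_def]
  rw [e]
  have h1 : Real.exp l ≤ 1 + l + l ^ 2 := by
    have := (abs_le.1 (Real.abs_exp_sub_one_sub_id_le hl)).2
    linarith
  have h2 : (p : ℝ) * Real.exp (l * (1 - p)) + (1 - p) * Real.exp (l * (0 - p))
      = (1 + p * (Real.exp l - 1)) * Real.exp (-(l * p)) := by
    have : l * (1 - (p : ℝ)) = l + -(l * p) := by ring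
    rw [this, Real.exp_add, zero_sub, mul_neg]
    ring
  have h3 : 1 + p * (Real.exp l - 1) ≤ Real.exp (p * (l + l ^ 2)) := by
    have h4 := Real.add_one_le_exp ((p : ℝ) * (l + l ^ 2))
    nlinarith
  rw [h2]
  calc _ ≤ Real.exp (p * (l + l ^ 2)) * Real.exp (-(l * p)) := by gcongr
    _ = _ := by rw [← Real.exp_add]; ring_nf

/-- A Chernoff bound for weighted sums of independent Bernoulli variables. -/
lemma measure_le_sum_bernoulli {ι : Type*} [Fintype ι] (r : ι → unitInterval) (c : ι → ℝ)
    (hc : ∀ e, |c e| ≤ 1) {R : ℝ} (hR : ∑ e, (r e : ℝ) ≤ R) {l : ℝ} (hl0 : 0 ≤ l) (hl1 : l ≤ 1)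
    (t : ℝ) :
    (Measure.pi fun e => bernoulliMeasure true false (r e)).real
      {x : ι → Bool | t ≤ ∑ e, c e * ((if x e = true then 1 else 0) - (r e : ℝ))}
      ≤ Real.exp (-l * t + l ^ 2 * R) := by
  set μ := Measure.pi fun e => bernoulliMeasure true false (r e)
  set Y : (ι → Bool) → ℝ := fun x => ∑ e, c e * ((if x e = true then 1 else 0) - (r e : ℝ))
  have h1 := measure_ge_le_exp_mul_mgf (μ := μ) (X := Y) t hl0 Integrable.of_finite
  refine h1.trans ?_
  have h2 : mgf Y μ l ≤ Real.exp (l ^ 2 * R) := by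
    have e : ∀ x : ι → Bool, Real.exp (l * Y x)
        = ∏ e, Real.exp (l * c e * ((if x e = true then 1 else 0) - (r e : ℝ))) := by
      intro x
      rw [← Real.exp_sum, Finset.mul_sum]
      simp only [mul_assoc]
    rw [mgf]
    simp_rw [e]
    rw [integral_fintype_prod_eq_prod (𝕜 := ℝ) (fun e (b : Bool) =>
      Real.exp (l * c e * ((if b = true then 1 else 0) - (r e : ℝ))))]
    calc _ ≤ ∏ e, Real.exp ((r e : ℝ) * l ^ 2) := by
          refine Finset.prod_le_prod (fun e _ => integral_nonneg fun _ => (Real.exp_pos _).le)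
            fun e _ => ?_
          have hce : |l * c e| ≤ l := by
            rw [abs_mul, abs_of_nonneg hl0]
            exact mul_le_of_le_one_right hl0 (hc e)
          refine (integral_exp_bernoulli_le (r e) (hce.trans hl1)).trans ?_
          have hr := (r e).2.1
          have : (l * c e) ^ 2 ≤ l ^ 2 := by
            rw [← sq_abs]
            gcongr
          gcongr
      _ = Real.exp (l ^ 2 * ∑ e, (r e : ℝ)) := by
          rw [← Real.exp_sum, Finset.mul_sum]
          simp only [mul_comm]
      _ ≤ _ := by gcongr
  calc _ ≤ Real.exp (-l * t) * Real.exp (l ^ 2 * R) := by gcongr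
    _ = _ := by rw [← Real.exp_add]

lemma measure_le_abs_sum_bernoulli {ι : Type*} [Fintype ι] (r : ι → unitInterval) (c : ι → ℝ)
    (hc : ∀ e, |c e| ≤ 1) {R : ℝ} (hR : ∑ e, (r e : ℝ) ≤ R) {l : ℝ} (hl0 : 0 ≤ l) (hl1 : l ≤ 1)
    (t : ℝ) :
    (Measure.pi fun e => bernoulliMeasure true false (r e)).real
      {x : ι → Bool | t ≤ |∑ e, c e * ((if x e = true then 1 else 0) - (r e : ℝ))|}
      ≤ 2 * Real.exp (-l * t + l ^ 2 * R) := by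
  have h1 := measure_le_sum_bernoulli r c hc hR hl0 hl1 t
  have h2 := measure_le_sum_bernoulli r (fun e => -c e) (fun e => by simpa using hc e) hR hl0
    hl1 t
  rw [two_mul]
  refine le_trans ?_ (add_le_add h1 h2)
  refine le_trans (measureReal_mono ?_) (measureReal_union_le _ _)
  intro x hx
  rcases le_abs.1 (show t ≤ |_| from hx) with h | h
  · exact Or.inl h
  · refine Or.inr ?_
    simpa only [Set.mem_ofPred_eq, neg_mul, Finset.sum_neg_distrib] using h

/-- A symmetric matrix with zero diagonal sums to twice the sum of its entries above the
diagonal. -/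
lemma sum_sum_eq_two_mul_sum_vertexPair {n : ℕ} (x : Fin n → Fin n → ℝ)
    (hx : ∀ u v, x u v = x v u) (h0 : ∀ u, x u u = 0) :
    ∑ u, ∑ v, x u v = 2 * ∑ e : VertexPair n, x e.1.1 e.1.2 := by
  have hsplit : ∀ u v : Fin n, x u v
      = (if u < v then x u v else 0) + (if v < u then x u v else 0) := by
    intro u v
    rcases lt_trichotomy u v with h | h | h
    · simp [h, h.not_gt]
    · simp [h, h0]
    · simp [h, h.not_gt]
  have h1 : ∑ e : VertexPair n, x e.1.1 e.1.2 = ∑ u, ∑ v, if u < v then x u v else 0 := by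
    rw [← Finset.sum_product', Finset.univ_product_univ, ← Finset.sum_filter]
    exact (Finset.sum_subtype (Finset.univ.filter fun e : Fin n × Fin n => e.1 < e.2)
      (by simp) fun e => x e.1 e.2).symm
  have h2 : ∑ u, ∑ v, (if v < u then x u v else 0) = ∑ u, ∑ v, if u < v then x u v else 0 := by
    rw [Finset.sum_comm]
    refine Finset.sum_congr rfl fun u _ => Finset.sum_congr rfl fun v _ => ?_
    rw [hx]
  rw [h1, two_mul]
  nth_rw 2 [← h2]
  simp_rw [← Finset.sum_add_distrib]
  exact Finset.sum_congr rfl fun u _ => Finset.sum_congr rfl fun v _ => hsplit u v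

lemma adj_graphOfBits {n : ℕ} (x : VertexPair n → Bool) (e : VertexPair n) :
    adj (graphOfBits x) e.1.1 e.1.2 = if x e = true then 1 else 0 := by
  have h : ¬ e.1.2 < e.1.1 := e.2.not_gt
  have he : (graphOfBits x).Adj e.1.1 e.1.2 ↔ x e = true := by
    simp [graphOfBits, e.2, h]
  by_cases hx : x e = true
  · rw [adj, if_pos (he.2 hx), if_pos hx]
  · rw [adj, if_neg fun h' => hx (he.1 h'), if_neg hx]

lemma form_adj_sub_edgeProb {n k : ℕ} (P f : Fin n → Fin k) (o : Option (Fin k))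
    (p q : unitInterval) (x : VertexPair n → Bool) :
    form f o (fun u v => adj (graphOfBits x) u v - edgeProb P p q u v)
      = 2 * ∑ e : VertexPair n, coef f o e.1.1 e.1.2 * ((if x e = true then 1 else 0)
          - ((if P e.1.1 = P e.1.2 then p else q : unitInterval) : ℝ)) := by
  rw [form, sum_sum_eq_two_mul_sum_vertexPair]
  · congr 1
    refine Finset.sum_congr rfl fun e _ => ?_
    rw [adj_graphOfBits, edgeProb, if_neg e.2.ne]
    split_ifs <;> rfl
  · intro u v
    rw [coef_symm, adj_symm, edgeProb_symm]
  · intro u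
    simp [adj, edgeProb]

lemma card_vertexPair_le (n : ℕ) : Fintype.card (VertexPair n) ≤ n ^ 2 := by
  have h := Fintype.card_subtype_le fun e : Fin n × Fin n => e.1 < e.2
  rw [Fintype.card_prod, Fintype.card_fin] at h
  rwa [sq]

/-- With high probability, all the linear forms are close to their expected values. The
exponential tail beats the number `(k + 1) k ^ n` of linear forms once `ω` is large. -/
lemma le_sbm_forall_form_le {n k : ℕ} (hn : 0 < n) (hk : 0 < k) (P : Fin n → Fin k)
    {a b ω η : ℝ} (hb : 0 < b) (hab : b < a) (hη : 0 < η) (hηa : η ≤ a)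
    (hω : 16 * a / η ^ 2 * (Real.log k + 1) < ω) {p q : unitInterval}
    (hp : (p : ℝ) = ω * a / n) (hq : (q : ℝ) = ω * b / n) :
    ENNReal.ofReal (1 - 2 * (k + 1) * Real.exp (-n)) ≤ sbm P p q
      {G | ∀ (f : Fin n → Fin k) (o : Option (Fin k)),
        |form f o (fun u v => adj G u v - edgeProb P (ω * a / n) (ω * b / n) u v)|
          ≤ η * ω * n} := by
  have ha : 0 < a := hb.trans hab
  have hnR : (0 : ℝ) < n := by exact_mod_cast hn
  have hkR : (1 : ℝ) ≤ k := by exact_mod_cast hk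
  have hlog : 0 ≤ Real.log k := Real.log_nonneg hkR
  have hω0 : 0 < ω := lt_of_le_of_lt (by positivity) hω
  set r : VertexPair n → unitInterval := fun e => if P e.1.1 = P e.1.2 then p else q with hr
  set μ := Measure.pi fun e : VertexPair n => bernoulliMeasure true false (r e) with hμ
  have hmeas : Measurable (graphOfBits (n := n)) := Measurable.of_discrete
  rw [sbm]
  refine le_trans ?_ (Measure.le_map_apply hmeas.aemeasurable _)
  rw [← hp, ← hq]
  set E : Set (VertexPair n → Bool) := graphOfBits ⁻¹' {G | ∀ (f : Fin n → Fin k)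
    (o : Option (Fin k)), |form f o (fun u v => adj G u v - edgeProb P p q u v)| ≤ η * ω * n}
    with hE
  have hR : ∑ e, (r e : ℝ) ≤ ω * a * n := by
    have hre : ∀ e, (r e : ℝ) ≤ ω * a / n := by
      intro e
      simp only [hr]
      split_ifs
      · exact hp.le
      · rw [hq]
        gcongr
    refine (Finset.sum_le_card_nsmul _ _ _ fun e _ => hre e).trans ?_
    rw [nsmul_eq_mul, Finset.card_univ]
    calc _ ≤ (n : ℝ) ^ 2 * (ω * a / n) := by
          gcongr
          exact_mod_cast card_vertexPair_le n
      _ = _ := by field_simp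
  -- With `t = η ω n / 2` and `R = ω a n`, the exponent `-l t + l² R` is minimal at `l = η / (4 a)`.
  have htail : ∀ (f : Fin n → Fin k) (o : Option (Fin k)),
      μ.real {x | η * ω * n / 2 ≤ |∑ e : VertexPair n, coef f o e.1.1 e.1.2 *
        ((if x e = true then 1 else 0) - (r e : ℝ))|}
        ≤ 2 * Real.exp (-(n * (Real.log k + 1))) := by
    intro f o
    refine (measure_le_abs_sum_bernoulli r (fun e => coef f o e.1.1 e.1.2)
      (fun e => abs_coef_le_one f o _ _) hR (l := η / (4 * a)) (by positivity)
      (by rw [div_le_one (by positivity)]; linarith) _).trans ?_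
    gcongr
    have h1 : -(η / (4 * a)) * (η * ω * n / 2) + (η / (4 * a)) ^ 2 * (ω * a * n)
        = -(n * (ω * (η ^ 2 / (16 * a)))) := by
      field_simp
      ring
    have h2 : Real.log k + 1 ≤ ω * (η ^ 2 / (16 * a)) := by
      have h3 : 16 * a / η ^ 2 * (Real.log k + 1) * (η ^ 2 / (16 * a)) = Real.log k + 1 := by
        field_simp
      rw [← h3]
      gcongr
    rw [h1]
    exact neg_le_neg (mul_le_mul_of_nonneg_left h2 hnR.le)
  have hsub : Eᶜ ⊆ ⋃ i ∈ (Finset.univ : Finset ((Fin n → Fin k) × Option (Fin k))),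
      {x | η * ω * n / 2 ≤ |∑ e : VertexPair n, coef i.1 i.2 e.1.1 e.1.2 *
        ((if x e = true then 1 else 0) - (r e : ℝ))|} := by
    intro x hx
    simp only [hE, Set.mem_compl_iff, Set.mem_preimage, Set.mem_ofPred_eq, not_forall,
      not_le] at hx
    obtain ⟨f, o, hx⟩ := hx
    rw [form_adj_sub_edgeProb, abs_mul, abs_two] at hx
    simp only [Set.mem_iUnion, Finset.mem_univ, exists_prop, true_and]
    refine ⟨(f, o), ?_⟩
    change η * ω * n / 2 ≤ |_|
    simp only [hr]
    linarith
  have hEc : μ.real Eᶜ ≤ 2 * (k + 1) * Real.exp (-n) := by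
    refine (measureReal_mono hsub (measure_ne_top _ _)).trans
      ((measureReal_biUnion_finset_le _ _).trans ?_)
    refine (Finset.sum_le_card_nsmul _ _ _ fun i _ => htail i.1 i.2).trans (le_of_eq ?_)
    have e : Real.exp (-(n * (Real.log k + 1))) = ((k : ℝ) ^ n)⁻¹ * Real.exp (-n) := by
      rw [show -(n * (Real.log k + 1)) = -(n * Real.log k) + -(n : ℝ) by ring, Real.exp_add,
        Real.exp_neg, Real.exp_nat_mul, Real.exp_log (by linarith)]
    rw [e, nsmul_eq_mul]
    simp only [Finset.card_univ, Fintype.card_prod, Fintype.card_option, Fintype.card_pi,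
      Fintype.card_fin, Finset.prod_const]
    push_cast
    field_simp
  have hEm : MeasurableSet E := E.toFinite.measurableSet
  have hone : μ.real E = 1 - μ.real Eᶜ := by
    rw [probReal_compl_eq_one_sub hEm]
    ring
  rw [← ofReal_measureReal]
  refine ENNReal.ofReal_le_ofReal ?_
  rw [hone]
  linarith

/-! ### The law of the chain -/

section Chain

variable {n k : ℕ} (G : SimpleGraph (Fin n)) (β : ℝ) (μ : Measure (KPartition n k))

instance [IsProbabilityMeasure μ] : IsProbabilityMeasure (chain G β μ) :=
  inferInstanceAs (IsProbabilityMeasure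
    (Kernel.trajMeasure (X := fun _ => KPartition n k) μ (historyKernel G β)))

lemma measurable_eval_kPartition (t : ℕ) :
    Measurable fun X : ℕ → KPartition n k => X t :=
  measurable_pi_apply t

/-- The Markov property for two consecutive states. -/
lemma chain_pair_apply [IsProbabilityMeasure μ] (t : ℕ)
    (R : Set (KPartition n k × KPartition n k)) :
    chain G β μ {X | (X t, X (t + 1)) ∈ R}
      = ∫⁻ X, step G β (X t) {y | (X t, y) ∈ R} ∂chain G β μ := by
  have hR : MeasurableSet R := R.toFinite.measurableSet
  have h := Kernel.map_frestrictLe_trajMeasure_compProd_eq_map_trajMeasure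
    (X := fun _ => KPartition n k) (μ₀ := μ) (κ := historyKernel G β) (a := t)
  have hm : Measurable fun p : ((_ : Finset.Iic t) → KPartition n k) × KPartition n k =>
      (p.1 ⟨t, Finset.mem_Iic.2 le_rfl⟩, p.2) :=
    ((measurable_pi_apply _).comp measurable_fst).prodMk measurable_snd
  have hS := hm hR
  have hf : Measurable (Preorder.frestrictLe (π := fun _ => KPartition n k) t) :=
    Preorder.measurable_frestrictLe t
  have h2 := congrArg (fun m => m
    ((fun p : ((_ : Finset.Iic t) → KPartition n k) × KPartition n k =>
      (p.1 ⟨t, Finset.mem_Iic.2 le_rfl⟩, p.2)) ⁻¹' R)) h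
  beta_reduce at h2
  rw [Measure.compProd_apply hS, Measure.map_apply (hf.prodMk (measurable_pi_apply _)) hS,
    lintegral_map (Kernel.measurable_kernel_prodMk_left hS) hf] at h2
  exact h2.symm

lemma chain_map_zero [IsProbabilityMeasure μ] :
    (chain G β μ).map (fun X => X 0) = μ := by
  have hf : Measurable (Preorder.frestrictLe (π := fun _ => KPartition n k) 0) :=
    Preorder.measurable_frestrictLe 0
  have he : (fun X : ℕ → KPartition n k => X 0)
      = (fun h : (i : Finset.Iic 0) → KPartition n k => h ⟨0, Finset.mem_Iic.2 le_rfl⟩)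
        ∘ Preorder.frestrictLe (π := fun _ => KPartition n k) 0 := rfl
  rw [he, ← Measure.map_map (measurable_pi_apply _) hf, chain, Kernel.trajMeasure,
    Measure.map_comp _ _ hf, Kernel.traj_map_frestrictLe, Kernel.partialTraj_self,
    Measure.id_comp, Measure.map_map (measurable_pi_apply _) (by fun_prop)]
  exact Measure.map_id

lemma chain_map_succ [IsProbabilityMeasure μ] (t : ℕ) :
    (chain G β μ).map (fun X => X (t + 1))
      = ((chain G β μ).map fun X => X t).bind (stepKernel G β) := by
  ext s hs
  rw [Measure.map_apply (measurable_eval_kPartition _) hs,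
    Measure.bind_apply hs (Kernel.aemeasurable _),
    lintegral_map (Kernel.measurable_coe _ hs) (measurable_eval_kPartition _)]
  exact chain_pair_apply G β μ t {p | p.2 ∈ s}

/-- If the initial law is dominated by an invariant measure up to a measure `ρ`, then the law of
every state is dominated by the same invariant measure up to the mass of `ρ`. -/
lemma exists_chain_map_le [IsProbabilityMeasure μ] {π ρ : Measure (KPartition n k)}
    (hπ : π.bind (stepKernel G β) = π) (hμ : μ ≤ π + ρ) (t : ℕ) :
    ∃ ρ' : Measure (KPartition n k), ρ' Set.univ = ρ Set.univ ∧
      (chain G β μ).map (fun X => X t) ≤ π + ρ' := by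
  induction t with
  | zero => exact ⟨ρ, rfl, by rwa [chain_map_zero]⟩
  | succ t ih =>
    obtain ⟨ρ', h1, h2⟩ := ih
    refine ⟨ρ'.bind (stepKernel G β), ?_, ?_⟩
    · rw [Measure.bind_apply MeasurableSet.univ (Kernel.aemeasurable _), ← h1]
      simp
    · rw [chain_map_succ]
      refine Measure.le_iff.2 fun s hs => ?_
      rw [Measure.bind_apply hs (Kernel.aemeasurable _)]
      refine (lintegral_mono' h2 le_rfl).trans (le_of_eq ?_)
      rw [lintegral_add_measure, ← Measure.bind_apply hs (Kernel.aemeasurable _),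
        ← Measure.bind_apply hs (Kernel.aemeasurable _), hπ, Measure.add_apply]

lemma measure_mem_le_of_dominated [IsProbabilityMeasure μ] {π ρ : Measure (KPartition n k)}
    (hπ : π.bind (stepKernel G β) = π) (hμ : μ ≤ π + ρ) (t : ℕ) (M : Set (KPartition n k)) :
    chain G β μ {X | X t ∈ M} ≤ π M + ρ Set.univ := by
  obtain ⟨ρ', h1, h2⟩ := exists_chain_map_le G β μ hπ hμ t
  have hM : MeasurableSet M := M.toFinite.measurableSet
  have h3 := h2 M
  rw [Measure.map_apply (measurable_eval_kPartition _) hM, Measure.add_apply] at h3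
  refine h3.trans ?_
  rw [← h1]
  gcongr
  exact Set.subset_univ M

lemma step_neighbours (A : KPartition n k) (h : (neighbours A).Nonempty) :
    step G β A {B | B ∉ neighbours A} = 0 := by
  rw [step, if_pos h]
  simp only [Measure.coe_finsetSum, Finset.sum_apply, Measure.smul_apply, smul_eq_mul]
  refine Finset.sum_eq_zero fun B hB => ?_
  rw [Measure.dirac_apply]
  simp [hB]

/-- Almost surely, the next state is a neighbour of the present one. -/
lemma chain_not_neighbour [IsProbabilityMeasure μ]
    (hne : ∀ A : KPartition n k, (neighbours A).Nonempty) (t : ℕ) :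
    chain G β μ {X | X (t + 1) ∉ neighbours (X t)} = 0 := by
  have h := chain_pair_apply G β μ t {p | p.2 ∉ neighbours p.1}
  simp only [Set.mem_ofPred_eq] at h
  rw [h]
  simp only [step_neighbours G β _ (hne _), lintegral_zero]

/-! ### Reversibility -/

/-- The normalising constant of the step from `A`. -/
def neighbourWeight (A : KPartition n k) : ℝ := ∑ B ∈ neighbours A, weight G β B

/-- The reversible measure of the chain, with density `w(A) ∑_{B ∼ A} w(B)`. -/
def revMeasure : Measure (KPartition n k) :=
  ∑ A : KPartition n k, ENNReal.ofReal (weight G β A * neighbourWeight G β A) • Measure.dirac A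

lemma revMeasure_bind (hn : 0 < n) (hne : ∀ A : KPartition n k, (neighbours A).Nonempty) :
    (revMeasure G β).bind (stepKernel (k := k) G β) = revMeasure G β := by
  classical
  ext s hs
  rw [Measure.bind_apply hs (Kernel.aemeasurable _), revMeasure,
    lintegral_finsetSum_measure]
  simp only [lintegral_smul_measure, lintegral_dirac, smul_eq_mul, Measure.coe_finsetSum,
    Finset.sum_apply, Measure.smul_apply]
  have hstep : ∀ A : KPartition n k,
      ENNReal.ofReal (weight G β A * neighbourWeight G β A) * stepKernel G β A s
      = ∑ B, if B ∈ neighbours A then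
          ENNReal.ofReal (weight G β A * weight G β B) * Measure.dirac B s else 0 := by
    intro A
    have hpos : 0 < neighbourWeight G β A :=
      Finset.sum_pos (fun C _ => weight_pos G β C) (hne A)
    have e : stepKernel G β A s = ∑ B ∈ neighbours A,
        ENNReal.ofReal (weight G β B / neighbourWeight G β A) * Measure.dirac B s := by
      change step G β A s = _
      rw [step, if_pos (hne A)]
      simp only [Measure.coe_finsetSum, Finset.sum_apply, Measure.smul_apply, smul_eq_mul,
        neighbourWeight]
    rw [e, Finset.mul_sum, ← Finset.sum_filter, Finset.filter_mem_eq_inter, Finset.univ_inter]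
    refine Finset.sum_congr rfl fun B _ => ?_
    rw [← mul_assoc, ← ENNReal.ofReal_mul (mul_nonneg (weight_pos G β A).le hpos.le)]
    congr 2
    field_simp
  simp_rw [hstep]
  rw [Finset.sum_comm]
  refine Finset.sum_congr rfl fun B _ => ?_
  simp_rw [mem_neighbours_comm hn (B := B)]
  rw [← Finset.sum_filter, Finset.filter_mem_eq_inter, Finset.univ_inter, ← Finset.sum_mul,
    ← ENNReal.ofReal_sum_of_nonneg
      (fun A _ => mul_nonneg (weight_pos G β A).le (weight_pos G β B).le),
    ← Finset.sum_mul, mul_comm (weight G β B)]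
  rfl

end Chain

/-! ### Hitting times -/

lemma le_hittingTime {α : Type*} (S : Set α) (X : ℕ → α) (r : ℝ)
    (h : ∀ t, X t ∈ S → r ≤ t) : ENNReal.ofReal r ≤ ((hittingTime S X : ℕ∞) : ℝ≥0∞) := by
  have h1 : ((⌈r⌉₊ : ℕ) : ℕ∞) ≤ hittingTime S X := by
    refine le_iInf₂ fun t ht => ?_
    exact_mod_cast Nat.ceil_le.2 (h t ht)
  have h2 : (((⌈r⌉₊ : ℕ) : ℕ∞) : ℝ≥0∞) ≤ ((hittingTime S X : ℕ∞) : ℝ≥0∞) := by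
    exact_mod_cast h1
  refine le_trans ?_ h2
  rw [ENat.toENNReal_coe]
  exact ENNReal.ofReal_le_of_le_toReal (by simpa using Nat.le_ceil r)

/-- A path of neighbours from the far region to the close region visits the region between. -/
lemma exists_mem_barrier {n k : ℕ} (hn : 0 < n) (P : KPartition n k) {ν₁ ν : ℝ}
    (hν : ν₁ + 1 / n < ν) (X : ℕ → KPartition n k) (h0 : X 0 ∈ far P ν)
    (hX : ∀ t, X (t + 1) ∈ neighbours (X t)) {t : ℕ} (ht : X t ∈ close P ν₁) :
    ∃ s < t, X s ∈ {A | ν₁ < distance P A ∧ distance P A < ν} := by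
  have hpos : (0 : ℝ) < 1 / n := by positivity
  by_contra! hcon
  have hfar : ∀ s ≤ t, ν ≤ distance P (X s) := by
    intro s
    induction s with
    | zero => exact fun _ => h0
    | succ s ih =>
      intro hs
      have h1 := ih (by omega)
      have h2 := distance_le_of_mem_neighbours hn P (hX s)
      by_contra! hlt
      rcases hs.lt_or_eq with hs | hs
      · exact hcon (s + 1) hs ⟨by linarith, hlt⟩
      · have h3 : distance P (X (s + 1)) ≤ ν₁ := by rw [hs]; exact ht
        linarith
  have h1 := hfar t le_rfl
  have h2 : distance P (X t) ≤ ν₁ := ht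
  linarith

/-! ### Escape from the far region -/

section Escape

variable {n k : ℕ} (G : SimpleGraph (Fin n)) (β : ℝ)

lemma gibbs_div_sum (A : KPartition n k) (s : Finset (KPartition n k)) :
    gibbs G β A / ∑ B ∈ s, gibbs G β B = weight G β A / ∑ B ∈ s, weight G β B := by
  have hZ : (∑ B : KPartition n k, weight G β B) ≠ 0 :=
    (Finset.sum_pos (fun C _ => weight_pos G β C) ⟨A, Finset.mem_univ A⟩).ne'
  simp only [gibbs]
  rw [← Finset.sum_div, div_div_div_cancel_right₀ hZ]

open Classical in
lemma gibbsOn_eq (S : Set (KPartition n k)) :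
    gibbsOn G β S = ∑ A : KPartition n k, ENNReal.ofReal (if A ∈ S then
      weight G β A / ∑ B ∈ Finset.univ.filter (fun B => B ∈ S), weight G β B else 0) •
        Measure.dirac A := by
  simp only [gibbsOn, gibbs_div_sum]

lemma isProbabilityMeasure_gibbsOn {S : Set (KPartition n k)} (hS : S.Nonempty) :
    IsProbabilityMeasure (gibbsOn G β S) := by
  classical
  obtain ⟨A, hA⟩ := hS
  have hpos : 0 < ∑ B ∈ Finset.univ.filter (fun B => B ∈ S), weight G β B :=
    Finset.sum_pos (fun C _ => weight_pos G β C) ⟨A, by simp [hA]⟩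
  constructor
  rw [gibbsOn_eq]
  simp only [Measure.coe_finsetSum, Finset.sum_apply, Measure.smul_apply, measure_univ,
    smul_eq_mul, mul_one]
  rw [← ENNReal.ofReal_sum_of_nonneg, ← Finset.sum_filter, ← Finset.sum_div, div_self hpos.ne',
    ENNReal.ofReal_one]
  intro B _
  split_ifs
  · exact div_nonneg (weight_pos G β B).le hpos.le
  · exact le_rfl

lemma weight_le (hβ : 0 ≤ β) {A : KPartition n k} {q : ℝ} (h : modularity G A ≤ q) :
    weight G β A ≤ Real.exp (β * n * q) := by
  rw [weight]
  gcongr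

lemma le_weight (hβ : 0 ≤ β) {A : KPartition n k} {q : ℝ} (h : q ≤ modularity G A) :
    Real.exp (β * n * q) ≤ weight G β A := by
  rw [weight]
  gcongr

lemma neighbourWeight_le (hβ : 0 ≤ β) {A : KPartition n k} {q : ℝ}
    (h : ∀ B ∈ neighbours A, modularity G B ≤ q) :
    neighbourWeight G β A ≤ (k : ℝ) ^ n * Real.exp (β * n * q) := by
  refine (Finset.sum_le_card_nsmul _ _ _ fun B hB => weight_le G β hβ (h B hB)).trans ?_
  rw [nsmul_eq_mul]
  gcongr
  exact_mod_cast (Finset.card_le_univ (neighbours A)).trans (card_kPartition_le n k)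

lemma le_neighbourWeight (hβ : 0 ≤ β) {A : KPartition n k} {q : ℝ}
    (hne : (neighbours A).Nonempty) (h : ∀ B ∈ neighbours A, q ≤ modularity G B) :
    Real.exp (β * n * q) ≤ neighbourWeight G β A := by
  obtain ⟨B, hB⟩ := hne
  exact (le_weight G β hβ (h B hB)).trans
    (Finset.single_le_sum (f := fun B => weight G β B) (fun C _ => (weight_pos G β C).le) hB)

/-- Modularity changes by at most `δ` in one step, so on partitions of modularity almost that
of `A₀` or larger, the Gibbs distribution is dominated by a multiple of the reversible measure.
Every other partition has exponentially small mass. -/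
lemma gibbsOn_le (hβ : 0 ≤ β) {S : Set (KPartition n k)} {A₀ : KPartition n k} (hA₀ : A₀ ∈ S)
    {δ : ℝ} (hne : ∀ A : KPartition n k, (neighbours A).Nonempty)
    (hδ : ∀ A B : KPartition n k, B ∈ neighbours A → |modularity G A - modularity G B| ≤ δ) :
    gibbsOn G β S ≤
      ENNReal.ofReal (Real.exp (-(β * n * (2 * modularity G A₀ - 2 * δ)))) • revMeasure G β
        + ∑ A : KPartition n k,
            ENNReal.ofReal (Real.exp (-(β * n * δ))) • Measure.dirac A := by
  classical
  rw [gibbsOn_eq, revMeasure, Finset.smul_sum, ← Finset.sum_add_distrib]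
  refine Finset.sum_le_sum fun A _ => ?_
  rw [smul_smul, ← add_smul, ← ENNReal.ofReal_mul (Real.exp_pos _).le]
  set q₀ := modularity G A₀ with hq₀
  have hN : 0 ≤ neighbourWeight G β A := Finset.sum_nonneg fun C _ => (weight_pos G β C).le
  have hwpos := weight_pos G β A
  rw [← ENNReal.ofReal_add (mul_nonneg (Real.exp_pos _).le (mul_nonneg hwpos.le hN))
    (Real.exp_pos _).le]
  have key : (if A ∈ S then
      weight G β A / ∑ B ∈ Finset.univ.filter (fun B => B ∈ S), weight G β B else 0)
      ≤ Real.exp (-(β * n * (2 * q₀ - 2 * δ))) * (weight G β A * neighbourWeight G β A)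
        + Real.exp (-(β * n * δ)) := by
    split_ifs with hA
    swap
    · positivity
    have hW : Real.exp (β * n * q₀)
        ≤ ∑ B ∈ Finset.univ.filter (fun B => B ∈ S), weight G β B :=
      Finset.single_le_sum (f := fun B => weight G β B) (fun C _ => (weight_pos G β C).le)
        (by simp [hA₀])
    have h1 : weight G β A / ∑ B ∈ Finset.univ.filter (fun B => B ∈ S), weight G β B
        ≤ weight G β A / Real.exp (β * n * q₀) := by gcongr
    refine h1.trans ?_
    rw [div_eq_mul_inv, ← Real.exp_neg]
    -- In the first case `N(A)` is bounded from below by the weight of any one neighbour.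
    by_cases hq : q₀ - δ ≤ modularity G A
    · have h2 : Real.exp (β * n * (q₀ - 2 * δ)) ≤ neighbourWeight G β A := by
        refine le_neighbourWeight G β hβ (hne A) fun B hB => ?_
        have := (abs_le.1 (hδ A B hB)).2
        linarith
      have h3 : Real.exp (-(β * n * q₀))
          = Real.exp (-(β * n * (2 * q₀ - 2 * δ))) * Real.exp (β * n * (q₀ - 2 * δ)) := by
        rw [← Real.exp_add]
        ring_nf
      rw [h3]
      have h4 : weight G β A * (Real.exp (-(β * n * (2 * q₀ - 2 * δ)))
            * Real.exp (β * n * (q₀ - 2 * δ)))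
          ≤ weight G β A * (Real.exp (-(β * n * (2 * q₀ - 2 * δ))) * neighbourWeight G β A) := by
        gcongr
      have h5 := Real.exp_pos (-(β * n * δ))
      linarith
    · push Not at hq
      have h2 : weight G β A ≤ Real.exp (β * n * (q₀ - δ)) := weight_le G β hβ hq.le
      have h3 : weight G β A * Real.exp (-(β * n * q₀)) ≤ Real.exp (-(β * n * δ)) := by
        calc _ ≤ Real.exp (β * n * (q₀ - δ)) * Real.exp (-(β * n * q₀)) := by gcongr
          _ = _ := by rw [← Real.exp_add]; ring_nf
      have h4 : 0 ≤ Real.exp (-(β * n * (2 * q₀ - 2 * δ)))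
          * (weight G β A * neighbourWeight G β A) := by positivity
      linarith
  refine Measure.le_iff.2 fun s _ => ?_
  simp only [Measure.smul_apply, smul_eq_mul]
  gcongr

lemma revMeasure_le (hβ : 0 ≤ β) {M : Set (KPartition n k)} {δ q : ℝ}
    (hδ : ∀ A B : KPartition n k, B ∈ neighbours A → |modularity G A - modularity G B| ≤ δ)
    (hM : ∀ A ∈ M, modularity G A ≤ q) :
    revMeasure G β M ≤
      ENNReal.ofReal (((k : ℝ) ^ n) ^ 2 * Real.exp (β * n * (2 * q + δ))) := by
  have hle : ∀ A : KPartition n k,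
      ENNReal.ofReal (weight G β A * neighbourWeight G β A) * Measure.dirac A M
        ≤ ENNReal.ofReal ((k : ℝ) ^ n * Real.exp (β * n * (2 * q + δ))) := by
    intro A
    rw [Measure.dirac_apply]
    by_cases hA : A ∈ M
    · simp only [hA, Set.indicator_of_mem, Pi.one_apply, mul_one]
      refine ENNReal.ofReal_le_ofReal ?_
      have h1 := weight_le G β hβ (hM A hA)
      have h2 : neighbourWeight G β A ≤ (k : ℝ) ^ n * Real.exp (β * n * (q + δ)) := by
        refine neighbourWeight_le G β hβ fun B hB => ?_
        have := (abs_le.1 (hδ A B hB)).1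
        linarith [hM A hA]
      calc _ ≤ Real.exp (β * n * q) * ((k : ℝ) ^ n * Real.exp (β * n * (q + δ))) :=
            mul_le_mul h1 h2 (Finset.sum_nonneg fun C _ => (weight_pos G β C).le)
              (Real.exp_pos _).le
        _ = (k : ℝ) ^ n * (Real.exp (β * n * q) * Real.exp (β * n * (q + δ))) := by ring
        _ = _ := by rw [← Real.exp_add]; ring_nf
    · simp [hA]
  have hcard : (Fintype.card (KPartition n k) : ℝ) ≤ (k : ℝ) ^ n := by
    exact_mod_cast card_kPartition_le n k
  rw [revMeasure]
  simp only [Measure.coe_finsetSum, Finset.sum_apply, Measure.smul_apply, smul_eq_mul]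
  refine (Finset.sum_le_card_nsmul _ _ _ fun A _ => hle A).trans ?_
  rw [nsmul_eq_mul, Finset.card_univ, ← ENNReal.ofReal_natCast,
    ← ENNReal.ofReal_mul (by positivity)]
  refine ENNReal.ofReal_le_ofReal ?_
  calc _ ≤ (k : ℝ) ^ n * ((k : ℝ) ^ n * Real.exp (β * n * (2 * q + δ))) := by gcongr
    _ = _ := by ring

/-- At every fixed time, the chain started from the Gibbs distribution on `S` is in `M` with
exponentially small probability, if the modularity on `M` is smaller by `γ` than that of some
`A₀ ∈ S` and `β γ` is large. -/
lemma chain_mem_barrier_le (hβ : 0 ≤ β) (hn : 0 < n) {S M : Set (KPartition n k)}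
    {A₀ : KPartition n k} (hA₀ : A₀ ∈ S) {γ : ℝ} (hγ : 0 ≤ γ)
    (hne : ∀ A : KPartition n k, (neighbours A).Nonempty)
    (hδ : ∀ A B : KPartition n k, B ∈ neighbours A →
      |modularity G A - modularity G B| ≤ γ / 4)
    (hM : ∀ A ∈ M, modularity G A + γ ≤ modularity G A₀)
    (hβγ : 4 * (4 + 2 * Real.log k) ≤ β * γ) (t : ℕ) :
    chain G β (gibbsOn G β S) {X | X t ∈ M} ≤ ENNReal.ofReal (2 * Real.exp (-4 * n)) := by
  have := isProbabilityMeasure_gibbsOn G β ⟨A₀, hA₀⟩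
  set C := ENNReal.ofReal (Real.exp (-(β * n * (2 * modularity G A₀ - 2 * (γ / 4))))) with hC
  have hinv : (C • revMeasure G β).bind (stepKernel (k := k) G β) = C • revMeasure G β := by
    ext s hs
    rw [Measure.bind_apply hs (Kernel.aemeasurable _), lintegral_smul_measure,
      ← Measure.bind_apply hs (Kernel.aemeasurable _), revMeasure_bind G β hn hne,
      Measure.smul_apply]
  have h := measure_mem_le_of_dominated G β (gibbsOn G β S) hinv
    (gibbsOn_le G β hβ hA₀ hne hδ) t M
  refine h.trans ?_
  have hk1 : (1 : ℝ) ≤ (k : ℝ) ^ n := by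
    obtain ⟨f, -⟩ := exists_mk A₀
    have hk : 1 ≤ k := by
      have := (f ⟨0, hn⟩).isLt
      omega
    exact one_le_pow₀ (by exact_mod_cast hk)
  have hcard : (Fintype.card (KPartition n k) : ℝ) ≤ (k : ℝ) ^ n := by
    exact_mod_cast card_kPartition_le n k
  have hr := revMeasure_le G β hβ (M := M) (q := modularity G A₀ - γ) hδ
    fun A hA => by linarith [hM A hA]
  -- The factor `k ^ (2 n)` is absorbed by the exponential.
  have hexp : ((k : ℝ) ^ n) ^ 2 * Real.exp (-(β * n * (γ / 4))) ≤ Real.exp (-4 * n) := by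
    have hkpos : (0 : ℝ) < k := by
      by_contra! h0
      have h0' : (k : ℝ) = 0 := le_antisymm h0 (by positivity)
      rw [h0', zero_pow hn.ne'] at hk1
      norm_num at hk1
    have e : ((k : ℝ) ^ n) ^ 2 = Real.exp (2 * n * Real.log k) := by
      rw [← pow_mul, ← Real.exp_log (pow_pos hkpos (n * 2)), Real.log_pow]
      push_cast
      ring_nf
    rw [e, ← Real.exp_add]
    refine Real.exp_le_exp.2 ?_
    have hn' : (0 : ℝ) ≤ n := by positivity
    nlinarith
  have h1 : (C • revMeasure G β) M ≤ ENNReal.ofReal (Real.exp (-4 * n)) := by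
    rw [Measure.smul_apply, smul_eq_mul]
    calc C * revMeasure G β M
        ≤ C * ENNReal.ofReal (((k : ℝ) ^ n) ^ 2 *
            Real.exp (β * n * (2 * (modularity G A₀ - γ) + γ / 4))) := by gcongr
      _ = ENNReal.ofReal (((k : ℝ) ^ n) ^ 2 * Real.exp (-(β * n * (5 * (γ / 4))))) := by
          rw [hC, ← ENNReal.ofReal_mul (Real.exp_pos _).le, mul_left_comm, ← Real.exp_add]
          ring_nf
      _ ≤ _ := by
          refine ENNReal.ofReal_le_ofReal (le_trans ?_ hexp)
          gcongr
          linarith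
  have h2 : (∑ A : KPartition n k, ENNReal.ofReal (Real.exp (-(β * n * (γ / 4)))) •
      Measure.dirac A) Set.univ ≤ ENNReal.ofReal (Real.exp (-4 * n)) := by
    simp only [Measure.coe_finsetSum, Finset.sum_apply, Measure.smul_apply, measure_univ,
      smul_eq_mul, mul_one, Finset.sum_const, nsmul_eq_mul, Finset.card_univ]
    rw [← ENNReal.ofReal_natCast, ← ENNReal.ofReal_mul (by positivity)]
    refine ENNReal.ofReal_le_ofReal (le_trans ?_ hexp)
    gcongr
    exact hcard.trans (by nlinarith)
  calc _ ≤ ENNReal.ofReal (Real.exp (-4 * n)) + ENNReal.ofReal (Real.exp (-4 * n)) :=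
        add_le_add h1 h2
    _ = _ := by rw [← ENNReal.ofReal_add (Real.exp_pos _).le (Real.exp_pos _).le, two_mul]

lemma gibbsOn_compl (S : Set (KPartition n k)) : gibbsOn G β S Sᶜ = 0 := by
  classical
  rw [gibbsOn_eq]
  simp only [Measure.coe_finsetSum, Finset.sum_apply, Measure.smul_apply, smul_eq_mul]
  refine Finset.sum_eq_zero fun A _ => ?_
  by_cases hA : A ∈ S
  · simp [hA]
  · simp [hA]

/-- Exponentially slow mixing, for every graph whose modularity has an energy barrier between the
far and the close region. -/
lemma le_chain_hittingTime (hβ : 0 ≤ β) (hk : 2 ≤ k) (hn : k < n) (P : KPartition n k)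
    {ν₁ ν γ : ℝ} (hν : ν₁ + 1 / n < ν) (hγ : 0 ≤ γ) {A₀ : KPartition n k} (hA₀ : A₀ ∈ far P ν)
    (hδ : ∀ A B : KPartition n k, B ∈ neighbours A →
      |modularity G A - modularity G B| ≤ γ / 4)
    (hM : ∀ A : KPartition n k, ν₁ < distance P A → distance P A < ν →
      modularity G A + γ ≤ modularity G A₀)
    (hβγ : 4 * (4 + 2 * Real.log k) ≤ β * γ) :
    ENNReal.ofReal (1 - Real.exp (-1 * n)) ≤ chain G β (gibbsOn G β (far P ν))
      {X | ENNReal.ofReal (Real.exp (1 * n)) ≤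
        ((hittingTime (close P ν₁) X : ℕ∞) : ℝ≥0∞)} := by
  have hn0 : 0 < n := by omega
  have hne := neighbours_nonempty hk hn
  have := isProbabilityMeasure_gibbsOn G β ⟨A₀, hA₀⟩
  set μ := gibbsOn G β (far P ν) with hμ
  set M : Set (KPartition n k) := {A | ν₁ < distance P A ∧ distance P A < ν}
  set E : Set (ℕ → KPartition n k) := {X | ENNReal.ofReal (Real.exp (1 * n)) ≤
    ((hittingTime (close P ν₁) X : ℕ∞) : ℝ≥0∞)}
  set N := ⌈Real.exp (1 * n)⌉₊ with hN
  have hsub : Eᶜ ⊆ {X | X 0 ∈ (far P ν)ᶜ} ∪ ((⋃ t, {X | X (t + 1) ∉ neighbours (X t)})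
      ∪ ⋃ t ∈ Finset.range N, {X | X t ∈ M}) := by
    intro X hX
    by_contra hcon
    simp only [Set.mem_union, Set.mem_iUnion, not_or, not_exists, Set.mem_ofPred_eq,
      Set.mem_compl_iff, not_not, Finset.mem_range] at hcon
    obtain ⟨h0, h1, h2⟩ := hcon
    refine hX (le_hittingTime _ _ _ fun t ht => ?_)
    obtain ⟨s, hs, hsM⟩ := exists_mem_barrier hn0 P hν X h0 h1 ht
    by_contra! hlt
    have : t < N := Nat.lt_ceil.2 hlt
    exact h2 s (by omega) hsM
  have h0 : chain G β μ {X | X 0 ∈ (far P ν)ᶜ} = 0 := by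
    have h := congrArg (fun m => m (far P ν)ᶜ) (chain_map_zero G β μ)
    beta_reduce at h
    rw [Measure.map_apply (measurable_eval_kPartition 0) (Set.toFinite _).measurableSet, hμ,
      gibbsOn_compl] at h
    exact h
  have h1 : chain G β μ (⋃ t, {X | X (t + 1) ∉ neighbours (X t)}) = 0 :=
    measure_iUnion_null fun t => chain_not_neighbour G β μ hne t
  have h2 : chain G β μ (⋃ t ∈ Finset.range N, {X | X t ∈ M})
      ≤ ENNReal.ofReal (Real.exp (-1 * n)) := by
    refine (measure_biUnion_finset_le _ _).trans ?_
    refine (Finset.sum_le_card_nsmul _ _ _ fun t _ => chain_mem_barrier_le G β hβ hn0 hA₀ hγ hne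
      hδ (fun A hA => hM A hA.1 hA.2) hβγ t).trans ?_
    rw [Finset.card_range, nsmul_eq_mul, ← ENNReal.ofReal_natCast,
      ← ENNReal.ofReal_mul (by positivity)]
    refine ENNReal.ofReal_le_ofReal ?_
    have hn1 : (1 : ℝ) ≤ n := by exact_mod_cast hn0
    have hexp1 : (1 : ℝ) ≤ Real.exp (1 * n) := Real.one_le_exp (by positivity)
    have hNle : (N : ℝ) ≤ 2 * Real.exp (1 * n) := by
      have := Nat.ceil_lt_add_one (Real.exp_pos (1 * n)).le
      rw [← hN] at this
      linarith
    have h4 : (4 : ℝ) ≤ Real.exp (2 * n) := by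
      have e : Real.exp (2 * n) = Real.exp n ^ 2 := by rw [← Real.exp_nat_mul]; norm_num
      have := Real.add_one_le_exp (n : ℝ)
      rw [e]
      nlinarith
    calc (N : ℝ) * (2 * Real.exp (-4 * n)) ≤ (2 * Real.exp (1 * n)) * (2 * Real.exp (-4 * n)) := by
          gcongr
      _ = 4 * Real.exp (-3 * n) := by
          rw [show (-3 * n : ℝ) = 1 * n + -4 * n by ring, Real.exp_add]
          ring
      _ ≤ Real.exp (2 * n) * Real.exp (-3 * n) := by gcongr
      _ = _ := by rw [← Real.exp_add]; ring_nf
  have hEc : chain G β μ Eᶜ ≤ ENNReal.ofReal (Real.exp (-1 * n)) := by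
    refine (measure_mono hsub).trans ((measure_union_le _ _).trans ?_)
    rw [h0, zero_add]
    refine (measure_union_le _ _).trans ?_
    rwa [h1, zero_add]
  rw [ENNReal.ofReal_sub _ (Real.exp_pos _).le, ENNReal.ofReal_one, tsub_le_iff_right]
  calc (1 : ℝ≥0∞) = chain G β μ (E ∪ Eᶜ) := by rw [Set.union_compl_self, measure_univ]
    _ ≤ chain G β μ E + chain G β μ Eᶜ := measure_union_le _ _
    _ ≤ _ := by gcongr

end Escape

/-! ### From the energy barrier to slow mixing -/

/-- If the modularity of every labelling is close to `κ score / n²`, the score gap gives an energy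
barrier for modularity, and slow mixing follows. -/
lemma le_chain_hittingTime_of_score_gap {n k : ℕ} (hk : 2 ≤ k) (hn : k < n)
    {P g : Fin n → Fin k} {ν₁ ν γ κ β : ℝ} (hν : ν₁ + 1 / n < ν) (hγ : 0 < γ) (hκ : 0 < κ)
    (hg : ν ≤ distance (KPartition.mk P) (KPartition.mk g))
    (hgap : ∀ f : Fin n → Fin k, ν₁ ≤ (hammingDist P f : ℝ) / n →
      (hammingDist P f : ℝ) / n ≤ ν → score P f + γ * n ^ 2 ≤ score P g)
    {G : SimpleGraph (Fin n)}
    (hG : ∀ f : Fin n → Fin k,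
      |modularityLabelled G f - κ * (score P f / n ^ 2)| ≤ κ * γ / 32)
    (hnγ : 32 < n * γ) (hβ : 0 ≤ β) (hβγ : 4 * (4 + 2 * Real.log k) ≤ β * (κ * γ / 2)) :
    ENNReal.ofReal (1 - Real.exp (-1 * n)) ≤
      chain G β (gibbsOn G β (far (KPartition.mk P) ν))
        {X | ENNReal.ofReal (Real.exp (1 * n)) ≤
          ((hittingTime (close (KPartition.mk P) ν₁) X : ℕ∞) : ℝ≥0∞)} := by
  have hn0 : 0 < n := by omega
  have hnR : (0 : ℝ) < n := by exact_mod_cast hn0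
  have hn2 : (0 : ℝ) < (n : ℝ) ^ 2 := by positivity
  have hmk : ∀ f : Fin n → Fin k, modularity G (KPartition.mk f) = modularityLabelled G f :=
    fun _ => rfl
  refine le_chain_hittingTime G β hβ hk hn (KPartition.mk P) hν (γ := κ * γ / 2)
    (A₀ := KPartition.mk g) (by positivity) hg ?_ ?_ hβγ
  · intro A B hAB
    obtain ⟨f, f', rfl, rfl, hd⟩ := exists_labellings_of_mem_neighbours hn0 hAB
    rw [hmk, hmk]
    have h1 := abs_score_sub_score_le P f f'
    rw [hd, Nat.cast_one, mul_one] at h1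
    have h2 : |κ * (score P f / n ^ 2) - κ * (score P f' / n ^ 2)| ≤ κ * γ / 16 := by
      rw [← mul_sub, ← sub_div, abs_mul, abs_div, abs_of_pos hκ, abs_of_pos hn2]
      calc _ ≤ κ * (2 * n / (n : ℝ) ^ 2) := by gcongr
        _ ≤ κ * (γ / 16) := by
            refine mul_le_mul_of_nonneg_left ?_ hκ.le
            rw [div_le_div_iff₀ hn2 (by norm_num)]
            nlinarith
        _ = _ := by ring
    have h3 := abs_le.1 (hG f)
    have h4 := abs_le.1 (hG f')
    have h5 := abs_le.1 h2
    rw [abs_le]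
    constructor <;> linarith [h3.1, h3.2, h4.1, h4.2, h5.1, h5.2]
  · intro A hA1 hA2
    obtain ⟨f, rfl, hd⟩ := exists_distance_eq_hammingDist hn0 P A
    rw [hd] at hA1 hA2
    have h1 := hgap f hA1.le hA2.le
    have h2 : κ * (score P f / n ^ 2) + κ * γ ≤ κ * (score P g / n ^ 2) := by
      rw [← mul_add]
      refine mul_le_mul_of_nonneg_left ?_ hκ.le
      rw [le_div_iff₀ hn2]
      have : (score P f / (n : ℝ) ^ 2 + γ) * n ^ 2 = score P f + γ * n ^ 2 := by field_simp
      linarith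
    rw [hmk, hmk]
    have h3 := abs_le.1 (hG f)
    have h4 := abs_le.1 (hG g)
    have h5 : 0 < κ * γ := by positivity
    linarith [h3.2, h4.1]

end SBM

end

theorem mainTheorem4 (k : ℕ) (hk : 3 ≤ k) (a b : ℝ) (hb : 0 < b) (hab : b < a)
    (ν : ℝ) (hν₁ : 1 / (2 * ((k : ℝ) - 1)) < ν) (hν₂ : ν < 1 / (k : ℝ)) :
    ∃ β₀ > (0 : ℝ), ∃ c₃ > (0 : ℝ), ∃ c₄ > (0 : ℝ), ∀ ε > (0 : ℝ), ∃ c > (0 : ℝ), ∃ n₀ : ℕ,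
      ∀ β ≥ β₀, ∀ n ≥ n₀, ∀ P : Fin n → Fin k, SBM.IsBalanced P →
      ∀ ω > c, ∀ p q : unitInterval, (p : ℝ) = ω * a / n → (q : ℝ) = ω * b / n →
        ENNReal.ofReal (1 - ε) ≤ SBM.sbm P p q
          {G | ENNReal.ofReal (1 - Real.exp (-c₄ * n)) ≤
            SBM.chain G β (SBM.gibbsOn G β (SBM.far (SBM.KPartition.mk P) ν))
              {X | ENNReal.ofReal (Real.exp (c₃ * n)) ≤
                ((SBM.hittingTime
                    (SBM.close (SBM.KPartition.mk P) (1 / (2 * ((k : ℝ) - 1)))) X : ℕ∞) :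
                  ℝ≥0∞)}} := by
  have ha : 0 < a := hb.trans hab
  have hkR : (3 : ℝ) ≤ k := by exact_mod_cast hk
  have hlog : 0 ≤ Real.log k := Real.log_nonneg (by linarith)
  obtain ⟨γ, hγ, n₁, hgap⟩ := SBM.exists_score_gap hk hν₁ hν₂
  set s := (a + (k - 1) * b) / k with hs
  have hspos : 0 < s := by
    have : 0 < ((k : ℝ) - 1) * b := mul_pos (by linarith) hb
    positivity
  set κ := (a - b) / s with hκ
  have hκpos : 0 < κ := div_pos (by linarith) hspos
  set K := 2 / s + 2 * a / s ^ 2 + 16 * k / s with hK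
  have hKpos : 0 < K := by positivity
  -- The admissible total error of the normalised linear forms.
  set h₀ := min (s / 2) (κ * γ / 32 / K) with hh₀
  have hh₀pos : 0 < h₀ := lt_min (by positivity) (by positivity)
  set η := min (h₀ / 2) a with hη
  have hηpos : 0 < η := lt_min (by positivity) ha
  refine ⟨8 * (4 + 2 * Real.log k) / (κ * γ), by positivity, 1, one_pos, 1, one_pos,
    fun ε hε => ?_⟩
  obtain ⟨n₂, hn₂⟩ := exists_nat_gt (1 / (ν - 1 / (2 * ((k : ℝ) - 1))))
  obtain ⟨n₃, hn₃⟩ := exists_nat_gt (32 / γ)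
  obtain ⟨n₄, hn₄⟩ := exists_nat_gt (4 * a / h₀)
  obtain ⟨n₅, hn₅⟩ := exists_nat_gt (2 * (k + 1) / ε)
  refine ⟨16 * a / η ^ 2 * (Real.log k + 1), by positivity,
    k + 1 + n₁ + n₂ + n₃ + n₄ + n₅, fun β hβ n hn P hP ω hω p q hp hq => ?_⟩
  have hkn : k < n := by omega
  have hn0 : 0 < n := by omega
  have hnR : (0 : ℝ) < n := by exact_mod_cast hn0
  have hn2 : 1 / (ν - 1 / (2 * ((k : ℝ) - 1))) < n :=
    hn₂.trans_le (by exact_mod_cast (by omega : n₂ ≤ n))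
  have hn3 : 32 / γ < n := hn₃.trans_le (by exact_mod_cast (by omega : n₃ ≤ n))
  have hn4 : 4 * a / h₀ < n := hn₄.trans_le (by exact_mod_cast (by omega : n₄ ≤ n))
  have hn5 : 2 * (k + 1) / ε < n := hn₅.trans_le (by exact_mod_cast (by omega : n₅ ≤ n))
  have hω0 : 0 < ω := lt_of_le_of_lt (by positivity) hω
  obtain ⟨g, hg, hgap⟩ := hgap n (by omega) P hP
  have hβ' : 4 * (4 + 2 * Real.log k) ≤ β * (κ * γ / 2) := by
    have h1 : 8 * (4 + 2 * Real.log k) / (κ * γ) ≤ β := hβ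
    rw [div_le_iff₀ (by positivity)] at h1
    linarith
  have hβ0 : 0 ≤ β := le_trans (by positivity) hβ
  have hprob := SBM.le_sbm_forall_form_le hn0 (by omega) P hb hab hηpos (min_le_right _ _) hω hp hq
  refine le_trans (ENNReal.ofReal_le_ofReal ?_) (hprob.trans (measure_mono fun G hG => ?_))
  · have h1 : Real.exp (-(n : ℝ)) ≤ 1 / n := by
      rw [Real.exp_neg, one_div]
      gcongr
      linarith [Real.add_one_le_exp (n : ℝ)]
    have h2 : 2 * ((k : ℝ) + 1) * Real.exp (-n) ≤ ε := by
      calc _ ≤ 2 * ((k : ℝ) + 1) * (1 / n) := by gcongr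
        _ ≤ ε := by
          rw [div_lt_iff₀ hε] at hn5
          rw [mul_one_div, div_le_iff₀ hnR]
          linarith
    linarith
  · have hh : η + 2 * a / n ≤ h₀ := by
      have h1 : η ≤ h₀ / 2 := min_le_left _ _
      have h2 : 2 * a / n ≤ h₀ / 2 := by
        rw [div_lt_iff₀ hh₀pos] at hn4
        rw [div_le_iff₀ hnR]
        linarith
      linarith
    refine SBM.le_chain_hittingTime_of_score_gap (by omega) hkn ?_ hγ hκpos hg hgap
      (fun f => ?_) ?_ hβ0 hβ'
    · rw [div_lt_comm₀ (by linarith) hnR] at hn2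
      linarith
    · refine (SBM.abs_modularityLabelled_sub_score_le hn0 ⟨0, by omega⟩ hP hb hab hω0 hG f hs rfl
        (hh.trans (min_le_left _ _))).trans ?_
      have h1 : h₀ * K ≤ κ * γ / 32 := by
        rw [← le_div_iff₀ hKpos]
        exact min_le_right _ _
      refine le_trans ?_ h1
      rw [← hK]
      gcongr
    · rw [div_lt_iff₀ hγ] at hn3
      exact hn3
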